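/- **Conventions.** Let $A$ be a finite alphabet, $A^+$ the semigroup of finite nonempty words and $A^\infty$ the set of infinite words over $A$; $\mathrm{alph}(w)$ is the set of letters of a word $w$. An $\omega$-semigroup $(S_+,S_\infty)$ consists of a semigroup $S_+$, a set $S_\infty$, a mixed product $S_+\times S_\infty\to S_\infty$ and an infinite product $(S_+)^{\mathbb N}\to S_\infty$, satisfying all forms of associativity; it is finite if $S_+$ and $S_\infty$ are. For example, $(A^+,A^\infty)$ with concatenation is an $\omega$-semigroup. For $s\in S_+$ put $s^\infty=sss\cdots\in S_\infty$; if $S_+$ is finite, $s^\omega$ denotes the idempotent power of $s$. A morphism $\alpha:(A^+,A^\infty)\to(S_+,S_\infty)$ consists of maps $\alpha_+:A^+\to S_+$ and $\alpha_\infty:A^\infty\to S_\infty$ that are compatible with all products. It is *alphabet compatible* if any two finite words with the same image under $\alpha_+$ have the same alphabet, and any two infinite words with the same image under $\alpha_\infty$ have the same alphabet. In this case, for $s$ in $S_+$ or in $S_\infty$, $\mathrm{alph}(s)$ denotes the common alphabet of all preimages of $s$ (and $\emptyset$ if there are none). View a finite or infinite word as a linearly ordered set of positions labelled by letters, and consider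 first-order sentences over the predicates $<$ and $P_a$ ($a\in A$; "position $x$ has label $a$"). A sentence is $\Sigma_2$ if pulling its quantifiers to the front leads to a prenex normal form with at most two blocks of quantifiers, which starts with an existential block if there are exactly two. Its quantifier rank is the largest number of nested quantifiers. For $k\in\mathbb N$ and two finite words, or two infinite words, $w,w'$, write $w\le_k w'$ if every $\Sigma_2$ sentence of quantifier rank at most $k$ that holds in $w$ also holds in $w'$. For $x\in\{+,\infty\}$, a pair $(s,t)\in (S_x)^2$ is a *$\Sigma_2$-chain of length $2$ for $\alpha_x$* if for every $k\in\mathbb N$ there are $u,v\in A^x$ with $u\le_k v$, $\alpha_x(u)=s$ and $\alpha_x(v)=t$. Let $\mathcal C_{2,2}[\alpha_x]\subseteq (S_x)^2$ be the set of these pairs. **Proposition.** Let $\alpha:(A^+,A^\infty)\to(S_+,S_\infty)$ be an alphabet compatible morphism into a finite $\omega$-semigroup. Then $$\mathcal C_{2,2}[\alpha_\infty]=\bigl\{(r_1 s_1^\infty,\; r_2 s_2^\omega t_2)\;:\;(r_1,r_2)\in\mathcal C_{2,2}[\alpha_+],\ (s_1,s_2)\in\mathcal C_{2,2}[\alpha_+],\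 t_2\in\alpha_\infty(A^\infty),\ \mathrm{alph}(s_1)=\mathrm{alph}(t_2)\bigr\}.$$ -/

import Mathlib

/-! ### Semigroups and ω-semigroups -/

namespace OmegaWords

open scoped FirstOrder

/-- `blockProd s i n` is the product `s i * s (i+1) * ⋯ * s (i+n)`, with `n + 1` factors. -/
def blockProd {S : Type*} [Semigroup S] (s : ℕ → S) (i : ℕ) : ℕ → S
  | 0 => s i
  | n + 1 => blockProd s i n * s (i + n + 1)

/-- `posPow s n` is the power `s ^ (n + 1)` in a semigroup. -/
def posPow {S : Type*} [Semigroup S] (s : S) : ℕ → S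
  | 0 => s
  | n + 1 => posPow s n * s

theorem coe_posPow {S : Type*} [Semigroup S] (s : S) (n : ℕ) :
    ((posPow s n : S) : WithOne S) = (s : WithOne S) ^ (n + 1) := by
  induction n with
  | zero => simp [posPow]
  | succ n ih => rw [posPow, WithOne.coe_mul, ih, pow_succ _ (n + 1)]

/-- In a finite semigroup there is an exponent `n + 1 ≥ 1` such that all `(n + 1)`-th powers are
idempotent. -/
theorem exists_idempotent_exponent (S : Type*) [Semigroup S] [Finite S] :
    ∃ n : ℕ, ∀ s : S, IsIdempotentElem (posPow s n) := by
  classical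
  cases nonempty_fintype S
  have key : ∀ s : S, ∃ m : ℕ, 0 < m ∧ IsIdempotentElem ((s : WithOne S) ^ m) := by
    intro s
    have : Finite (WithOne S) := inferInstanceAs (Finite (Option S))
    obtain ⟨a, b, hab, h⟩ := Finite.exists_ne_map_eq_of_infinite (fun n : ℕ => (s : WithOne S) ^ n)
    wlog hlt : a < b generalizing a b
    · exact this b a hab.symm h.symm (by omega)
    obtain ⟨p, rfl⟩ := Nat.exists_eq_add_of_lt hlt
    have h1 : ∀ c, (s : WithOne S) ^ (a + c) = (s : WithOne S) ^ (a + c + (p + 1)) := by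
      intro c
      rw [pow_add, h, ← pow_add]
      congr 1
      omega
    have h2 : ∀ q c, (s : WithOne S) ^ (a + c) = (s : WithOne S) ^ (a + c + q * (p + 1)) := by
      intro q
      induction q with
      | zero => simp
      | succ q ih =>
        intro c
        rw [ih c, add_assoc a c, h1]
        congr 1
        ring
    refine ⟨(a + 1) * (p + 1), by positivity, ?_⟩
    have h3 := h2 (a + 1) ((a + 1) * (p + 1) - a)
    have h4 : a ≤ (a + 1) * (p + 1) := by nlinarith
    rw [Nat.add_sub_cancel' h4] at h3
    rw [IsIdempotentElem, ← pow_add]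
    exact h3.symm
  choose m hm hi using key
  have hpos : 0 < ∏ s, m s := Finset.prod_pos fun s _ => hm s
  refine ⟨∏ s, m s - 1, fun s => ?_⟩
  have h5 : ((posPow s (∏ s, m s - 1) : S) : WithOne S) = (s : WithOne S) ^ m s := by
    rw [coe_posPow, Nat.sub_add_cancel hpos]
    obtain ⟨c, hc⟩ := Finset.dvd_prod_of_mem m (Finset.mem_univ s)
    rw [hc, pow_mul, (hi s).pow_eq]
    rintro rfl
    simp [hc] at hpos
  have h6 := hi s
  rw [← h5, IsIdempotentElem, ← WithOne.coe_mul] at h6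
  exact WithOne.coe_inj.1 h6

open Classical in
/-- The power `s ^ ω` of an element of a finite semigroup `S`, where `ω = ω(S) ≥ 1` is an exponent
for which all `ω`-th powers in `S` are idempotent (the least one). -/
noncomputable def omegaPow {S : Type*} [Semigroup S] [Finite S] (s : S) : S :=
  posPow s (Nat.find (exists_idempotent_exponent S))

/-- `S` and `T` are the two components `S₊` and `S_∞` of an ω-semigroup: `S` is a semigroup which
acts on `T` by the mixed product `s • t`, and there is an infinite product of sequences of elements
of `S`, with values in `T`. All products are associative: the law `(s * s') • t = s • (s' • t)` is
`mul_smul`; the other two laws are the fields below. -/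
class OmegaSemigroup (S T : Type*) [Semigroup S] extends SemigroupAction S T where
  /-- The infinite product `s₀ s₁ s₂ ⋯`. -/
  iprod : (ℕ → S) → T
  /-- `s (s₀ s₁ s₂ ⋯) = s s₀ s₁ s₂ ⋯`. -/
  smul_iprod : ∀ (s : S) (f : ℕ → S), s • iprod f = iprod (fun n => Nat.casesOn n s f)
  /-- `s₀ s₁ s₂ ⋯ = (s₀ ⋯ s_{k₁ - 1}) (s_{k₁} ⋯ s_{k₂ - 1}) ⋯` for `0 = k₀ < k₁ < k₂ < ⋯`. -/
  iprod_blocks : ∀ (f : ℕ → S) (k : ℕ → ℕ), StrictMono k → k 0 = 0 →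
    iprod f = iprod (fun n => blockProd f (k n) (k (n + 1) - k n - 1))

/-- The infinite power `s^∞ = s s s ⋯`. -/
def infPow {S : Type*} (T : Type*) [Semigroup S] [OmegaSemigroup S T] (s : S) : T :=
  OmegaSemigroup.iprod (fun _ => s)

/-- Morphisms of ω-semigroups `(S, T) → (S', T')`. -/
structure OmegaHom (S T S' T' : Type*) [Semigroup S] [OmegaSemigroup S T]
    [Semigroup S'] [OmegaSemigroup S' T'] where
  /-- The component on finite words, a semigroup morphism. -/
  fin : S →ₙ* S'
  /-- The component on infinite words. -/
  inf : T → T'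
  map_smul : ∀ (s : S) (t : T), inf (s • t) = fin s • inf t
  map_iprod : ∀ f : ℕ → S,
    inf (OmegaSemigroup.iprod f) = OmegaSemigroup.iprod (fun n => fin (f n))

/-! ### Finite and infinite words

`A⁺` is the free semigroup `FreeSemigroup A`, `A^∞` is the type `Stream' A` of sequences. -/

/-- The list of letters of a finite nonempty word. -/
def letters {A : Type*} (u : FreeSemigroup A) : List A := u.head :: u.tail

theorem letters_mul {A : Type*} (u v : FreeSemigroup A) :
    letters (u * v) = letters u ++ letters v := rfl

theorem lt_length_blockProd {A : Type*} (w : ℕ → FreeSemigroup A) (i n : ℕ) :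
    n < (letters (blockProd w i n)).length := by
  induction n with
  | zero => simp [letters]
  | succ n ih =>
    rw [blockProd, letters_mul, List.length_append]
    simp only [letters, List.length_cons] at ih ⊢
    omega

/-- The infinite concatenation `w₀ w₁ w₂ ⋯` of nonempty words: its letter at position `n` is the
letter at position `n` of `w₀ w₁ ⋯ wₙ`. -/
def concat {A : Type*} (w : ℕ → FreeSemigroup A) : Stream' A :=
  fun n => (letters (blockProd w 0 n))[n]'(lt_length_blockProd w 0 n)

theorem getElem?_blockProd_add {A : Type*} (w : ℕ → FreeSemigroup A) (i m d n : ℕ)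
    (h : n < (letters (blockProd w i m)).length) :
    (letters (blockProd w i (m + d)))[n]? = (letters (blockProd w i m))[n]? := by
  induction d with
  | zero => rfl
  | succ d ih =>
    rw [← add_assoc, blockProd, letters_mul, List.getElem?_append_left, ih]
    by_contra hc
    rw [List.getElem?_eq_none (not_lt.1 hc), List.getElem?_eq_getElem h] at ih
    simp at ih

/-- The letters of `w₀ w₁ w₂ ⋯` can be read off from any sufficiently long prefix. -/
theorem concat_spec {A : Type*} (w : ℕ → FreeSemigroup A) (m n : ℕ)
    (h : n < (letters (blockProd w 0 m)).length) :
    (letters (blockProd w 0 m))[n]? = some ((concat w).get n) := by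
  have h1 : (letters (blockProd w 0 n))[n]? = some ((concat w).get n) :=
    List.getElem?_eq_getElem (lt_length_blockProd w 0 n)
  rw [← h1]
  rcases le_total m n with hmn | hmn
  · obtain ⟨d, rfl⟩ := Nat.exists_eq_add_of_le hmn
    exact (getElem?_blockProd_add w 0 m d _ h).symm
  · obtain ⟨d, rfl⟩ := Nat.exists_eq_add_of_le hmn
    exact getElem?_blockProd_add w 0 n d n (lt_length_blockProd w 0 n)

theorem blockProd_mul_blockProd {S : Type*} [Semigroup S] (s : ℕ → S) (i m n : ℕ) :
    blockProd s i m * blockProd s (i + m + 1) n = blockProd s i (m + n + 1) := by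
  induction n with
  | zero => rfl
  | succ n ih =>
    rw [blockProd, ← mul_assoc, ih, ← add_assoc m n 1, blockProd]
    congr 2
    omega

theorem blockProd_cons {S : Type*} [Semigroup S] (s : S) (f : ℕ → S) (n : ℕ) :
    blockProd (fun n => (Nat.casesOn n s f : S)) 0 (n + 1) = s * blockProd f 0 n := by
  induction n with
  | zero => simp [blockProd]
  | succ n ih =>
    rw [blockProd, ih, mul_assoc]
    congr 1

theorem blockProd_blocks {S : Type*} [Semigroup S] (f : ℕ → S) (k : ℕ → ℕ)
    (hk : StrictMono k) (h0 : k 0 = 0) (n : ℕ) :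
    blockProd (fun n => blockProd f (k n) (k (n + 1) - k n - 1)) 0 n
      = blockProd f 0 (k (n + 1) - 1) := by
  induction n with
  | zero => simp [blockProd, h0]
  | succ n ih =>
    have h1 : k 0 < k (n + 1) := hk (by omega)
    have h2 : k (n + 1) < k (n + 2) := hk (by omega)
    have h3 := blockProd_mul_blockProd f 0 (k (n + 1) - 1) (k (n + 2) - k (n + 1) - 1)
    have h4 : 0 + (k (n + 1) - 1) + 1 = k (n + 1) := by omega
    have h5 : k (n + 1) - 1 + (k (n + 2) - k (n + 1) - 1) + 1 = k (n + 2) - 1 := by omega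
    rw [h4, h5] at h3
    rw [blockProd, ih, Nat.zero_add, h3]

/-- The ω-semigroup `(A⁺, A^∞)`. -/
instance instOmegaSemigroupWords (A : Type*) : OmegaSemigroup (FreeSemigroup A) (Stream' A) where
  smul u x := letters u ++ₛ x
  mul_smul u v x := by
    change letters (u * v) ++ₛ x = letters u ++ₛ (letters v ++ₛ x)
    rw [letters_mul, Stream'.append_append_stream]
  iprod := concat
  smul_iprod u w := by
    refine Stream'.ext fun n => Option.some_injective _ ?_
    rw [← concat_spec _ (n + 1) n
      ((Nat.lt_succ_self n).trans (lt_length_blockProd _ 0 (n + 1))), blockProd_cons, letters_mul]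
    change some ((letters u ++ₛ concat w).get n) = _
    by_cases h : n < (letters u).length
    · rw [List.getElem?_append_left h, Stream'.get_append_left _ _ _ h, List.getElem?_eq_getElem h]
    · obtain ⟨m, rfl⟩ := Nat.exists_eq_add_of_le (not_lt.1 h)
      rw [List.getElem?_append_right (by omega), Stream'.get_append_right, Nat.add_sub_cancel_left,
        concat_spec]
      exact lt_of_le_of_lt (by omega) (lt_length_blockProd w 0 _)
  iprod_blocks w k hk h0 := by
    refine Stream'.ext fun n => Option.some_injective _ ?_
    have h1 := lt_length_blockProd (fun n => blockProd w (k n) (k (n + 1) - k n - 1)) 0 n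
    rw [← concat_spec _ n n h1]
    rw [blockProd_blocks w k hk h0] at h1 ⊢
    rw [concat_spec w _ n h1]

/-- The alphabet of a finite word, i.e. its set of letters. -/
def contentFin {A : Type*} (u : FreeSemigroup A) : Set A := {a | a ∈ letters u}

/-- The alphabet of an infinite word, i.e. its set of letters. -/
def contentInf {A : Type*} (x : Stream' A) : Set A := Set.range x.get

section Alphabet

variable {A S T : Type*} [Semigroup S] [OmegaSemigroup S T]

/-- Alphabet compatible morphisms: words with the same image have the same alphabet. -/
def AlphabetCompatible (α : OmegaHom (FreeSemigroup A) (Stream' A) S T) : Prop :=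
  (∀ u v, α.fin u = α.fin v → contentFin u = contentFin v) ∧
    (∀ x y, α.inf x = α.inf y → contentInf x = contentInf y)

/-- The alphabet of `s ∈ S₊` for the morphism `α`: the union of the alphabets of the preimages
of `s`. If `α` is alphabet compatible, this is the common alphabet of all preimages of `s`, and `∅`
if `s` has no preimage. -/
def alphFin (α : OmegaHom (FreeSemigroup A) (Stream' A) S T) (s : S) : Set A :=
  ⋃ (u) (_ : α.fin u = s), contentFin u

/-- The alphabet of `t ∈ S_∞` for the morphism `α`, defined in the same way. -/
def alphInf (α : OmegaHom (FreeSemigroup A) (Stream' A) S T) (t : T) : Set A :=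
  ⋃ (x) (_ : α.inf x = t), contentInf x

theorem AlphabetCompatible.alphFin_eq {α : OmegaHom (FreeSemigroup A) (Stream' A) S T}
    (h : AlphabetCompatible α) (u : FreeSemigroup A) : alphFin α (α.fin u) = contentFin u := by
  ext a
  simp only [alphFin, Set.mem_iUnion]
  exact ⟨fun ⟨v, hv, ha⟩ => h.1 v u hv ▸ ha, fun ha => ⟨u, rfl, ha⟩⟩

theorem AlphabetCompatible.alphInf_eq {α : OmegaHom (FreeSemigroup A) (Stream' A) S T}
    (h : AlphabetCompatible α) (x : Stream' A) : alphInf α (α.inf x) = contentInf x := by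
  ext a
  simp only [alphInf, Set.mem_iUnion]
  exact ⟨fun ⟨v, hv, ha⟩ => h.2 v x hv ▸ ha, fun ha => ⟨x, rfl, ha⟩⟩

end Alphabet

/-! ### First-order logic over words -/

/-- The quantifier rank of a formula: the largest number of nested quantifiers. -/
def qrank {L : FirstOrder.Language} {V : Type*} : ∀ {n : ℕ}, L.BoundedFormula V n → ℕ
  | _, .falsum => 0
  | _, .equal _ _ => 0
  | _, .rel _ _ => 0
  | _, .imp φ ψ => max (qrank φ) (qrank ψ)
  | _, .all φ => qrank φ + 1

/-- The levels of the quantifier alternation hierarchy: `InLevel true i φ` says that `φ` is a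
`Σ_i` formula, `InLevel false i φ` that `φ` is a `Π_i` formula. These are the formulas for which
pulling out the quantifiers leads to a prenex normal form with at most `i` blocks of quantifiers
that starts with an existential (resp. universal) block if it has exactly `i` blocks. As the formula
itself need not be prenex, its quantifier rank is the one of the formula before the quantifiers are
pulled out. The connectives of the syntax are `⊥` and `→`, so the rule `imp` accounts for all
Boolean connectives: `Σ_i` is closed under `∧` and `∨`, and `¬ φ` is `Σ_i` if `φ` is `Π_i`. -/
inductive InLevel {L : FirstOrder.Language} {V : Type*} :
    Bool → ℕ → ∀ {n : ℕ}, L.BoundedFormula V n → Prop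
  | qf (b : Bool) (i : ℕ) {n : ℕ} {φ : L.BoundedFormula V n} (h : φ.IsQF) : InLevel b i φ
  | imp {b : Bool} {i n : ℕ} {φ ψ : L.BoundedFormula V n}
      (hφ : InLevel (!b) i φ) (hψ : InLevel b i ψ) : InLevel b i (φ.imp ψ)
  | ex {i n : ℕ} {φ : L.BoundedFormula V (n + 1)}
      (h : InLevel true (i + 1) φ) : InLevel true (i + 1) φ.ex
  | all {i n : ℕ} {φ : L.BoundedFormula V (n + 1)}
      (h : InLevel false (i + 1) φ) : InLevel false (i + 1) φ.all
  | succ (b' : Bool) {b : Bool} {i n : ℕ} {φ : L.BoundedFormula V n}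
      (h : InLevel b i φ) : InLevel b' (i + 1) φ

/-- `Σ_i` sentences. -/
def IsSigma {L : FirstOrder.Language} (i : ℕ) (φ : L.Sentence) : Prop := InLevel true i φ

/-- The relation symbols of the first-order logic of words over `A`: a unary predicate `P_a` for
each letter `a` and a binary predicate `<`. -/
inductive WordRel (A : Type*) : ℕ → Type _
  | letter (a : A) : WordRel A 1
  | lt : WordRel A 2

/-- The first-order language of words over `A`. -/
abbrev wordLang (A : Type*) : FirstOrder.Language := ⟨fun _ => Empty, WordRel A⟩

/-- The structure given by positions `P` with a strict order `<` and a labelling by letters. -/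
@[reducible] def wordStructure {A P : Type*} [LT P] (w : P → A) : (wordLang A).Structure P where
  funMap := fun f _ => Empty.elim f
  RelMap := fun R x =>
    match R, x with
    | .letter a, x => w (x 0) = a
    | .lt, x => x 0 < x 1

/-- `w ⊨ φ`, for a labelled order `w` and a sentence `φ`. -/
def Satisfies {A P : Type*} [LT P] (w : P → A) (φ : (wordLang A).Sentence) : Prop :=
  letI := wordStructure w
  P ⊨ φ

/-- Every `Σ_i` sentence of rank at most `k` which holds in `w` holds in `w'`. -/
def SigmaLE {A P P' : Type*} [LT P] [LT P'] (i k : ℕ) (w : P → A) (w' : P' → A) : Prop :=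
  ∀ φ : (wordLang A).Sentence, IsSigma i φ → qrank φ ≤ k → Satisfies w φ → Satisfies w' φ

/-- The preorder `SigmaLE` on finite words `u`, with positions `0, …, |u| - 1`. -/
def SigmaLEFin {A : Type*} (i k : ℕ) (u v : FreeSemigroup A) : Prop :=
  SigmaLE i k (letters u).get (letters v).get

/-- The preorder `SigmaLE` on infinite words, with positions `0, 1, 2, …`. -/
def SigmaLEInf {A : Type*} (i k : ℕ) (x y : Stream' A) : Prop :=
  SigmaLE i k x.get y.get

/-! ### Chains -/

/-- The chains of length `n` for a map `β : W → S` and a family of preorders `le k` on `W`: tuples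
`(s₁, …, sₙ)` such that for every `k` there are `w₁ ≤ₖ w₂ ≤ₖ ⋯ ≤ₖ wₙ` with `β wⱼ = sⱼ`. -/
def chains {W S : Type*} (le : ℕ → W → W → Prop) (n : ℕ) (β : W → S) : Set (Fin n → S) :=
  {s | ∀ k : ℕ, ∃ w : Fin n → W,
    (∀ (j : ℕ) (h : j + 1 < n), le k (w ⟨j, by omega⟩) (w ⟨j + 1, h⟩)) ∧ ∀ j, β (w j) = s j}

/-- The set of `Σ_i`-chains of length `n` for a map `β` on finite words. -/
def sigmaChainsFin {A S : Type*} (i n : ℕ) (β : FreeSemigroup A → S) : Set (Fin n → S) :=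
  chains (SigmaLEFin i) n β

/-- The set of `Σ_i`-chains of length `n` for a map `β` on infinite words. -/
def sigmaChainsInf {A S : Type*} (i n : ℕ) (β : Stream' A → S) : Set (Fin n → S) :=
  chains (SigmaLEInf i) n β

/-- The set of all pairs `(r₁ s₁^∞, r₂ s₂^ω t₂)` such that `(r₁, r₂)` and `(s₁, s₂)` are `Σ₂`-chains
of length `2` for `α` on finite words, and `t₂` is the image of an infinite word and has the same
alphabet as `s₁`. -/
def satSigma2 {A S T : Type*} [Semigroup S] [Finite S] [OmegaSemigroup S T]
    (α : OmegaHom (FreeSemigroup A) (Stream' A) S T) : Set (Fin 2 → T) :=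
  {q | ∃ (r₁ r₂ s₁ s₂ : S) (t₂ : T),
    ![r₁, r₂] ∈ sigmaChainsFin 2 2 α.fin ∧ ![s₁, s₂] ∈ sigmaChainsFin 2 2 α.fin ∧
    t₂ ∈ Set.range α.inf ∧ alphFin α s₁ = alphInf α t₂ ∧
    q = ![r₁ • infPow T s₁, (r₂ * omegaPow s₂) • t₂]}

end OmegaWords

/-!
Two facts about `Σ₂` carry the proof.

**The game.** The preorder `SigmaLE i k` is described by an Ehrenfeucht–Fraïssé game in which
Spoiler may change the structure at most `i - 1` times (`sigmaLE_iff_wins`). That the preorder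
provides a winning strategy also on infinite words is due to the finiteness of the alphabet:
finitely many formulas of each rank suffice (`exists_finite_formulas`). Strategies can be
concatenated (`Wins.append`), so the preorders are compatible with products of words, and they can
be restricted to the factors between corresponding pebbles (`Wins.restrict`).

**Finite supports.** A `Σ₂` sentence that holds in a word holds in all substructures that contain
some finite set of positions (`exists_support`), because witnesses for the outer existential
quantifiers are kept and the inner quantifiers are universal. If all letters of `x` occur in `u`,
then `uᴺ x` embeds into `u^∞` with the prefix `uᴺ` fixed. Hence `u^∞ ≤ₖ uᴺ x` for all large `N`, as
only finitely many sentences have to be considered (`eventually_infPow_sigmaLE_posPow_smul`).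

For the inclusion of `satSigma2 α` in the set of chains, take `u₀ ≤ₖ v₀` and `u₁ ≤ₖ v₁` with images
`(r₁, r₂)` and `(s₁, s₂)`, and `x` with image `t₂`. Then `u₀ u₁^∞ ≤ₖ u₀ u₁ᴺ x ≤ₖ v₀ v₁ᴺ x`, where
`N` is chosen such that `s₂ᴺ = s₂^ω`.

For the converse, let `x ≤ₗ y` with `l` much larger than `k`. Cut `x` into blocks that, except for
the first one, all have the same image (`exists_factorization`), and let Spoiler pebble the first
`|S| + 1` cuts. The answers cut `y` into factors that are related by `≤ₖ` to those of `x`, and the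
remaining tails have the same alphabet. Two of the prefixes of `y` that end at a cut have the same
image `r₂`; if `s₂` is the image of the factor between these two cuts, then `r₂ = r₂ s₂ = r₂ s₂^ω`
(`exists_decomposition`). Since `S` and `T` are finite, one tuple `(r₁, r₂, s₁, s₂, t₂)` arises for
all `k`.
-/

namespace OmegaWords

open FirstOrder Language

/-! ### Realization of formulas in labelled orders -/

section Realization

variable {A P P' : Type*} [LinearOrder P] [LinearOrder P'] {w : P → A} {w' : P' → A} {n : ℕ}

/-- `Holds w φ xs`: the formula `φ` holds in the labelled order `w` if its variables are assigned
the positions `xs`. -/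
def Holds (w : P → A) (φ : (wordLang A).BoundedFormula Empty n) (xs : Fin n → P) : Prop :=
  letI := wordStructure w
  φ.Realize Empty.elim xs

theorem satisfies_iff_holds (φ : (wordLang A).Sentence) :
    Satisfies w φ ↔ Holds w φ Fin.elim0 := by
  let := wordStructure w
  change BoundedFormula.Realize φ default default ↔ BoundedFormula.Realize φ _ _
  rw [Subsingleton.elim (default : Empty → P) Empty.elim,
    Subsingleton.elim (default : Fin 0 → P) Fin.elim0]

theorem holds_bot (xs : Fin n → P) :
    Holds w (⊥ : (wordLang A).BoundedFormula Empty n) xs ↔ False := Iff.rfl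

theorem holds_imp (φ ψ : (wordLang A).BoundedFormula Empty n) (xs : Fin n → P) :
    Holds w (φ.imp ψ) xs ↔ (Holds w φ xs → Holds w ψ xs) := Iff.rfl

theorem holds_not (φ : (wordLang A).BoundedFormula Empty n) (xs : Fin n → P) :
    Holds w φ.not xs ↔ ¬ Holds w φ xs := Iff.rfl

theorem holds_all (φ : (wordLang A).BoundedFormula Empty (n + 1)) (xs : Fin n → P) :
    Holds w φ.all xs ↔ ∀ b, Holds w φ (Fin.snoc xs b) := Iff.rfl

theorem holds_ex (φ : (wordLang A).BoundedFormula Empty (n + 1)) (xs : Fin n → P) :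
    Holds w φ.ex xs ↔ ∃ b, Holds w φ (Fin.snoc xs b) := by
  let := wordStructure w
  exact BoundedFormula.realize_ex

theorem term_eq_var (t : (wordLang A).Term (Empty ⊕ Fin n)) : ∃ i, t = Term.var (Sum.inr i) := by
  cases t with
  | var v =>
    rcases v with e | i
    · exact e.elim
    · exact ⟨i, rfl⟩
  | func f => exact Empty.elim f

/-- Quantifier-free formulas depend only on the labels, the order and the equality of the
positions. -/
theorem holds_congr_of_isQF {φ : (wordLang A).BoundedFormula Empty n} (hφ : φ.IsQF)
    {xs : Fin n → P} {ys : Fin n → P'} (hl : ∀ i, w (xs i) = w' (ys i))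
    (ho : ∀ i j, xs i < xs j ↔ ys i < ys j) : Holds w φ xs ↔ Holds w' φ ys := by
  have he : ∀ i j, xs i = xs j ↔ ys i = ys j := by
    intro i j
    simp only [eq_iff_le_not_lt, ← not_lt, ho]
  induction hφ with
  | falsum => exact Iff.rfl
  | of_isAtomic h =>
    cases h with
    | equal t₁ t₂ =>
      obtain ⟨i, rfl⟩ := term_eq_var t₁
      obtain ⟨j, rfl⟩ := term_eq_var t₂
      exact he i j
    | rel R ts =>
      choose v hv using fun i => term_eq_var (ts i)
      obtain rfl : ts = fun i => Term.var (Sum.inr (v i)) := funext hv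
      cases R with
      | letter a =>
        change w (xs (v 0)) = a ↔ w' (ys (v 0)) = a
        rw [hl]
      | lt => exact ho (v 0) (v 1)
  | imp _ _ ih₁ ih₂ => exact imp_congr ih₁ ih₂

/-- The formula stating that the `i`-th position has label `a`. -/
def letterFormula (a : A) (i : Fin n) : (wordLang A).BoundedFormula Empty n :=
  Relations.boundedFormula (L := wordLang A) (WordRel.letter a) fun _ => Term.var (Sum.inr i)

/-- The formula stating that the `i`-th position is smaller than the `j`-th one. -/
def ltFormula (i j : Fin n) : (wordLang A).BoundedFormula Empty n :=
  Relations.boundedFormula (L := wordLang A) WordRel.lt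
    ![Term.var (Sum.inr i), Term.var (Sum.inr j)]

theorem isQF_letterFormula (a : A) (i : Fin n) : (letterFormula a i).IsQF :=
  .of_isAtomic (.rel _ _)

theorem isQF_ltFormula (i j : Fin n) : (ltFormula (A := A) i j).IsQF :=
  .of_isAtomic (.rel _ _)

end Realization

section Levels

variable {L : FirstOrder.Language} {V : Type*} {n : ℕ}

theorem qrank_of_isQF {φ : L.BoundedFormula V n} (h : φ.IsQF) : qrank φ = 0 := by
  induction h with
  | falsum => rfl
  | of_isAtomic h => cases h <;> rfl
  | imp _ _ ih₁ ih₂ => simp [qrank, ih₁, ih₂]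

theorem qrank_not (φ : L.BoundedFormula V n) : qrank φ.not = qrank φ := by
  change max (qrank φ) 0 = _
  simp

theorem qrank_ex (φ : L.BoundedFormula V (n + 1)) : qrank φ.ex = qrank φ + 1 := by
  change max (max (qrank φ) 0 + 1) 0 = _
  simp

theorem InLevel.isQF {b : Bool} {φ : L.BoundedFormula V n} (h : InLevel b 0 φ) : φ.IsQF := by
  generalize hi : 0 = i at h
  induction h with
  | qf _ _ h => exact h
  | imp _ _ ih₁ ih₂ => exact (ih₁ hi).imp (ih₂ hi)
  | ex => omega
  | all => omega
  | succ => omega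

theorem InLevel.not {b : Bool} {i : ℕ} {φ : L.BoundedFormula V n} (h : InLevel (!b) i φ) :
    InLevel b i φ.not :=
  .imp h (.qf _ _ .falsum)

/-- The `Σ_i` formulas of bounded rank are closed under finite conjunctions. -/
theorem exists_conj {A : Type*} {i k : ℕ} {S : Set ((wordLang A).BoundedFormula Empty n)}
    (hS : S.Finite) (h : ∀ φ ∈ S, InLevel true i φ ∧ qrank φ ≤ k) :
    ∃ ψ : (wordLang A).BoundedFormula Empty n, (InLevel true i ψ ∧ qrank ψ ≤ k) ∧
      ∀ {P : Type} [LinearOrder P] (w : P → A) (xs : Fin n → P),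
        Holds w ψ xs ↔ ∀ φ ∈ S, Holds w φ xs := by
  induction S, hS using Set.Finite.induction_on with
  | empty =>
    have hq : (BoundedFormula.not (⊥ : (wordLang A).BoundedFormula Empty n)).IsQF :=
      .imp .falsum .falsum
    refine ⟨_, ⟨.qf _ _ hq, by simp [qrank_of_isQF hq]⟩, fun w xs => ?_⟩
    simp [holds_not, holds_bot]
  | @insert φ S _ _ ih =>
    obtain ⟨ψ, hψ, hr⟩ := ih fun χ hχ => h χ (Set.mem_insert_of_mem _ hχ)
    obtain ⟨h1, h2⟩ := h φ (Set.mem_insert _ _)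
    refine ⟨(φ.imp ψ.not).not, ⟨.not (.imp (b := false) h1 (.not (b := false) hψ.1)), ?_⟩,
      fun w xs => ?_⟩
    · rw [qrank_not, qrank, qrank_not]
      exact max_le h2 hψ.2
    · simp [holds_not, holds_imp, hr]

end Levels

/-! ### The Ehrenfeucht–Fraïssé game for `Σ_i` -/

section Pebbles

variable {P P' : Type}

theorem swap_preimage_insert (ρ : Set (P × P')) (b : P) (b' : P') :
    Prod.swap ⁻¹' insert (b, b') ρ = insert (b', b) (Prod.swap ⁻¹' ρ) := by
  ext ⟨p, q⟩
  simp [and_comm]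

/-- The pairs of positions pebbled by two assignments of `n` variables. -/
abbrev pebbles {n : ℕ} (xs : Fin n → P) (ys : Fin n → P') : Set (P × P') :=
  Set.range fun j => (xs j, ys j)

theorem pebbles_snoc {n : ℕ} (xs : Fin n → P) (ys : Fin n → P') (b : P) (b' : P') :
    pebbles (Fin.snoc xs b : Fin (n + 1) → P) (Fin.snoc ys b') =
      insert (b, b') (pebbles xs ys) := by
  ext p
  simp only [Set.mem_range, Set.mem_insert_iff, Fin.exists_fin_succ', Fin.snoc_castSucc,
    Fin.snoc_last]
  rw [or_comm, eq_comm (a := p)]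

theorem swap_preimage_pebbles {n : ℕ} (xs : Fin n → P) (ys : Fin n → P') :
    Prod.swap ⁻¹' pebbles xs ys = pebbles ys xs := by
  ext ⟨p, q⟩
  simp [and_comm]

theorem pebbles_elim0 : pebbles (Fin.elim0 : Fin 0 → P) (Fin.elim0 : Fin 0 → P') = ∅ :=
  Set.range_eq_empty _

end Pebbles

section Game

variable {A : Type*}

/-- The pairs of pebbled positions in `ρ` form a partial isomorphism of labelled orders. -/
def Compat {P P' : Type} [LinearOrder P] [LinearOrder P'] (w : P → A) (w' : P' → A)
    (ρ : Set (P × P')) : Prop :=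
  ∀ p ∈ ρ, w p.1 = w' p.2 ∧ ∀ q ∈ ρ, (p.1 < q.1 ↔ p.2 < q.2)

/-- Duplicator wins the `k`-round game for `Σ_i` on `w`, `w'` that starts with the pebbled pairs
`ρ`: in each round Spoiler pebbles a position of `w` and Duplicator answers in `w'`, and before any
round Spoiler may exchange the roles of `w` and `w'` at the price of lowering `i` by one. The game
ends after `k` rounds, or when `i` reaches `0`; then the pebbled pairs have to form a partial
isomorphism. -/
def Wins : ℕ → ℕ → ∀ {P P' : Type} [LinearOrder P] [LinearOrder P'],
    (P → A) → (P' → A) → Set (P × P') → Prop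
  | 0, _, _, _, _, _, w, w', ρ => Compat w w' ρ
  | _ + 1, 0, _, _, _, _, w, w', ρ => Compat w w' ρ
  | i + 1, k + 1, P, P', _, _, w, w', ρ =>
    Wins i (k + 1) w' w (Prod.swap ⁻¹' ρ) ∧
      ∀ b : P, ∃ b' : P', Wins (i + 1) k w w' (insert (b, b') ρ)
termination_by i k => (i, k)

variable {P P' : Type} [LinearOrder P] [LinearOrder P'] {w : P → A} {w' : P' → A}
  {ρ σ : Set (P × P')} {i k : ℕ}

theorem wins_zero : Wins 0 k w w' ρ ↔ Compat w w' ρ := by rw [Wins]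

theorem wins_rank_zero : Wins i 0 w w' ρ ↔ Compat w w' ρ := by cases i <;> rw [Wins]

theorem wins_succ : Wins (i + 1) (k + 1) w w' ρ ↔ Wins i (k + 1) w' w (Prod.swap ⁻¹' ρ) ∧
    ∀ b, ∃ b', Wins (i + 1) k w w' (insert (b, b') ρ) := by rw [Wins]

theorem Compat.swap (h : Compat w w' ρ) : Compat w' w (Prod.swap ⁻¹' ρ) :=
  fun _ hp => ⟨(h _ hp).1.symm, fun _ hq => ((h _ hp).2 _ hq).symm⟩

theorem Compat.mono (h : Compat w w' ρ) (hs : σ ⊆ ρ) : Compat w w' σ :=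
  fun p hp => ⟨(h p (hs hp)).1, fun q hq => (h p (hs hp)).2 q (hs hq)⟩

theorem Wins.compat (h : Wins i k w w' ρ) : Compat w w' ρ := by
  induction i generalizing P P' k with
  | zero => rwa [wins_zero] at h
  | succ i ih =>
    cases k with
    | zero => rwa [wins_rank_zero] at h
    | succ k => exact (ih (wins_succ.1 h).1).swap

theorem Wins.mono (h : Wins i k w w' ρ) (hs : σ ⊆ ρ) : Wins i k w w' σ := by
  induction i generalizing P P' k with
  | zero => exact wins_zero.2 (h.compat.mono hs)
  | succ i ih =>
    induction k generalizing ρ σ with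
    | zero => exact wins_rank_zero.2 (h.compat.mono hs)
    | succ k ihk =>
      obtain ⟨h1, h2⟩ := wins_succ.1 h
      refine wins_succ.2 ⟨ih h1 fun p hp => hs hp, fun b => ?_⟩
      obtain ⟨b', hb'⟩ := h2 b
      exact ⟨b', ihk hb' (Set.insert_subset_insert hs)⟩

theorem Wins.of_rank_succ (h : Wins i (k + 1) w w' ρ) : Wins i k w w' ρ := by
  induction i generalizing P P' k with
  | zero => exact wins_zero.2 h.compat
  | succ i ih =>
    induction k generalizing ρ with
    | zero => exact wins_rank_zero.2 h.compat
    | succ k ihk =>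
      obtain ⟨h1, h2⟩ := wins_succ.1 h
      refine wins_succ.2 ⟨ih h1, fun b => ?_⟩
      obtain ⟨b', hb'⟩ := h2 b
      exact ⟨b', ihk hb'⟩

theorem Wins.of_level_succ (h : Wins (i + 1) k w w' ρ) : Wins i k w w' ρ := by
  induction i generalizing P P' k with
  | zero => exact wins_zero.2 h.compat
  | succ i ih =>
    induction k generalizing ρ with
    | zero => exact wins_rank_zero.2 h.compat
    | succ k ihk =>
      obtain ⟨h1, h2⟩ := wins_succ.1 h
      refine wins_succ.2 ⟨ih h1, fun b => ?_⟩
      obtain ⟨b', hb'⟩ := h2 b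
      exact ⟨b', ihk hb'⟩

theorem Wins.swap (h : Wins (i + 1) k w w' ρ) : Wins i k w' w (Prod.swap ⁻¹' ρ) := by
  cases k with
  | zero => exact wins_rank_zero.2 h.compat.swap
  | succ k => exact (wins_succ.1 h).1

theorem Wins.exists_answer (h : Wins (i + 1) (k + 1) w w' ρ) (b : P) :
    ∃ b', Wins (i + 1) k w w' (insert (b, b') ρ) :=
  (wins_succ.1 h).2 b

/-- A winning strategy of Duplicator preserves `Σ_i` formulas from `w` to `w'` and `Π_i` formulas
from `w'` to `w`. -/
theorem Wins.preserves {n : ℕ} {b : Bool} {φ : (wordLang A).BoundedFormula Empty n}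
    (hφ : InLevel b i φ) (hk : qrank φ ≤ k) {P P' : Type} [LinearOrder P] [LinearOrder P']
    {w : P → A} {w' : P' → A} {xs : Fin n → P} {ys : Fin n → P'}
    (h : Wins i k w w' (pebbles xs ys)) :
    (b = true → Holds w φ xs → Holds w' φ ys) ∧ (b = false → Holds w' φ ys → Holds w φ xs) := by
  have key : ∀ {n : ℕ} {φ : (wordLang A).BoundedFormula Empty n}, φ.IsQF →
      ∀ {P P' : Type} [LinearOrder P] [LinearOrder P'] {w : P → A} {w' : P' → A} {xs : Fin n → P}
      {ys : Fin n → P'}, Compat w w' (pebbles xs ys) → (Holds w φ xs ↔ Holds w' φ ys) :=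
    fun hq _ _ _ _ _ _ _ _ hc => holds_congr_of_isQF hq (fun j => (hc _ ⟨j, rfl⟩).1)
      fun j l => (hc _ ⟨j, rfl⟩).2 _ ⟨l, rfl⟩
  induction hφ generalizing k P P' with
  | qf _ _ hq =>
    have := key hq h.compat
    exact ⟨fun _ => this.1, fun _ => this.2⟩
  | @imp b _ _ _ _ _ _ ih₁ ih₂ =>
    rw [qrank, max_le_iff] at hk
    have h1 := ih₁ hk.1 h
    have h2 := ih₂ hk.2 h
    simp only [holds_imp]
    cases b <;> simp at h1 h2 ⊢ <;> tauto
  | ex _ ih =>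
    rw [qrank_ex] at hk
    obtain ⟨k, rfl⟩ : ∃ l, k = l + 1 := ⟨k - 1, by omega⟩
    refine ⟨fun _ => ?_, by simp⟩
    simp only [holds_ex]
    rintro ⟨b, hb⟩
    obtain ⟨b', hb'⟩ := h.exists_answer b
    rw [← pebbles_snoc] at hb'
    exact ⟨b', (ih (by omega) hb').1 rfl hb⟩
  | all _ ih =>
    rw [qrank] at hk
    obtain ⟨k, rfl⟩ : ∃ l, k = l + 1 := ⟨k - 1, by omega⟩
    refine ⟨by simp, fun _ => ?_⟩
    simp only [holds_all]
    intro hall b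
    obtain ⟨b', hb'⟩ := h.exists_answer b
    rw [← pebbles_snoc] at hb'
    exact (ih (by omega) hb').2 rfl (hall b')
  | succ b' _ ih =>
    have h1 := ih hk h.of_level_succ
    have h2 := h.swap
    rw [swap_preimage_pebbles] at h2
    have h3 := ih hk h2
    exact ⟨fun _ => by grind, fun _ => by grind⟩

/-- For each rank finitely many `Σ_i` formulas suffice to guarantee a winning strategy: those that
start with an existential quantifier describe the answers Duplicator needs in the first round, and
the negated ones serve if Spoiler exchanges the structures. -/
theorem exists_finite_formulas [Finite A] (i k n : ℕ) :
    ∃ F : Set ((wordLang A).BoundedFormula Empty n), F.Finite ∧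
      (∀ φ ∈ F, InLevel true i φ ∧ qrank φ ≤ k) ∧
      ∀ {P P' : Type} [LinearOrder P] [LinearOrder P'] (w : P → A) (w' : P' → A)
        (xs : Fin n → P) (ys : Fin n → P'),
        (∀ φ ∈ F, Holds w φ xs → Holds w' φ ys) → Wins i k w w' (pebbles xs ys) := by
  -- the quantifier-free formulas that describe partial isomorphisms
  have base : ∀ i k n : ℕ, ∃ F : Set ((wordLang A).BoundedFormula Empty n), F.Finite ∧
      (∀ φ ∈ F, InLevel true i φ ∧ qrank φ ≤ k) ∧
      ∀ {P P' : Type} [LinearOrder P] [LinearOrder P'] (w : P → A) (w' : P' → A)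
        (xs : Fin n → P) (ys : Fin n → P'),
        (∀ φ ∈ F, Holds w φ xs → Holds w' φ ys) → Compat w w' (pebbles xs ys) := by
    intro i k n
    have hq : ∀ φ : (wordLang A).BoundedFormula Empty n, φ.IsQF →
        InLevel true i φ ∧ qrank φ ≤ k :=
      fun φ h => ⟨.qf _ _ h, by simp [qrank_of_isQF h]⟩
    refine ⟨Set.range (fun p : A × Fin n => letterFormula p.1 p.2) ∪
      (Set.range (fun p : Fin n × Fin n => ltFormula p.1 p.2) ∪
        Set.range (fun p : Fin n × Fin n => (ltFormula p.1 p.2).not)),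
      (Set.finite_range _).union ((Set.finite_range _).union (Set.finite_range _)), ?_, ?_⟩
    · rintro φ (⟨p, rfl⟩ | ⟨p, rfl⟩ | ⟨p, rfl⟩)
      · exact hq _ (isQF_letterFormula _ _)
      · exact hq _ (isQF_ltFormula _ _)
      · exact hq _ (.imp (isQF_ltFormula _ _) .falsum)
    · rintro P P' _ _ w w' xs ys h _ ⟨a, rfl⟩
      refine ⟨(h _ (.inl ⟨(w (xs a), a), rfl⟩) rfl).symm, ?_⟩
      rintro _ ⟨c, rfl⟩
      exact ⟨h _ (.inr (.inl ⟨(a, c), rfl⟩)),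
        not_imp_not.1 (h _ (.inr (.inr ⟨(a, c), rfl⟩)))⟩
  induction i generalizing k n with
  | zero => simpa only [wins_zero] using base 0 k n
  | succ i ih =>
    induction k generalizing n with
    | zero => simpa only [wins_rank_zero] using base (i + 1) 0 n
    | succ k ihk =>
      obtain ⟨F, hF, hF1, hF2⟩ := ih (k + 1) n
      obtain ⟨E, hE, hE1, hE2⟩ := ihk (n + 1)
      choose! ψ hψ1 hψ2 using fun (S : Set ((wordLang A).BoundedFormula Empty (n + 1)))
        (hS : S ⊆ E) => exists_conj (hE.subset hS) fun φ hφ => hE1 φ (hS hφ)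
      refine ⟨BoundedFormula.not '' F ∪ (fun S => (ψ S).ex) '' {S | S ⊆ E},
        (hF.image _).union (hE.finite_subsets.image _), ?_, ?_⟩
      · rintro _ (⟨φ, hφ, rfl⟩ | ⟨S, hS, rfl⟩)
        · exact ⟨.not (.succ _ (hF1 φ hφ).1), by rw [qrank_not]; exact (hF1 φ hφ).2⟩
        · exact ⟨.ex (hψ1 S hS).1, by rw [qrank_ex]; exact Nat.succ_le_succ (hψ1 S hS).2⟩
      · intro P P' _ _ w w' xs ys h
        refine wins_succ.2 ⟨?_, fun b => ?_⟩
        · rw [swap_preimage_pebbles]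
          exact hF2 w' w ys xs fun φ hφ => not_imp_not.1 (h _ (.inl ⟨φ, hφ, rfl⟩))
        · -- the answer to `b` satisfies all formulas of `E` that `b` satisfies
          have hS : {φ ∈ E | Holds w φ (Fin.snoc xs b)} ⊆ E := Set.sep_subset _ _
          have h1 := h _ (.inr ⟨_, hS, rfl⟩)
          rw [holds_ex, holds_ex] at h1
          obtain ⟨b', hb'⟩ := h1 ⟨b, (hψ2 _ hS _ _).2 fun φ hφ => hφ.2⟩
          refine ⟨b', ?_⟩
          rw [← pebbles_snoc]
          exact hE2 _ _ _ _ fun φ hφ hw => (hψ2 _ hS _ _).1 hb' φ ⟨hφ, hw⟩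

theorem Wins.sigmaLE (h : Wins i k w w' ∅) : SigmaLE i k w w' := by
  intro φ hφ hk
  rw [← pebbles_elim0] at h
  rw [satisfies_iff_holds, satisfies_iff_holds]
  exact (Wins.preserves hφ hk h).1 rfl

variable (A) in
/-- Finitely many `Σ_i` sentences of rank at most `k` determine the preorder `SigmaLE i k`. -/
theorem exists_finite_sentences [Finite A] (i k : ℕ) :
    ∃ F : Set (wordLang A).Sentence, F.Finite ∧ (∀ φ ∈ F, IsSigma i φ ∧ qrank φ ≤ k) ∧
      ∀ {P P' : Type} [LinearOrder P] [LinearOrder P'] (w : P → A) (w' : P' → A),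
        (∀ φ ∈ F, Satisfies w φ → Satisfies w' φ) → Wins i k w w' ∅ := by
  obtain ⟨F, hF, h1, h2⟩ := exists_finite_formulas (A := A) i k 0
  refine ⟨F, hF, h1, fun w w' h => ?_⟩
  rw [← pebbles_elim0]
  refine h2 w w' _ _ fun φ hφ => ?_
  rw [← satisfies_iff_holds, ← satisfies_iff_holds]
  exact h φ hφ

theorem sigmaLE_iff_wins [Finite A] : SigmaLE i k w w' ↔ Wins i k w w' ∅ := by
  refine ⟨fun h => ?_, Wins.sigmaLE⟩
  obtain ⟨F, -, h1, h2⟩ := exists_finite_sentences A i k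
  exact h2 w w' fun φ hφ => h φ (h1 φ hφ).1 (h1 φ hφ).2

/-- Strategies on two consecutive intervals combine to a strategy on their union. -/
theorem Wins.append {P₁ P₂ P₁' P₂' : Type} [LinearOrder P₁] [LinearOrder P₂] [LinearOrder P₁']
    [LinearOrder P₂'] {f : P₁ → P} {g : P₂ → P} {f' : P₁' → P'} {g' : P₂' → P'}
    (hf : StrictMono f) (hg : StrictMono g) (hf' : StrictMono f') (hg' : StrictMono g')
    (hlt : ∀ a b, f a < g b) (hlt' : ∀ a b, f' a < g' b)
    (hc : ∀ p, p ∈ Set.range f ∪ Set.range g) (hc' : ∀ p, p ∈ Set.range f' ∪ Set.range g')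
    {ρ₁ : Set (P₁ × P₁')} {ρ₂ : Set (P₂ × P₂')}
    (h₁ : Wins i k (w ∘ f) (w' ∘ f') ρ₁) (h₂ : Wins i k (w ∘ g) (w' ∘ g') ρ₂)
    (hρ : ρ ⊆ Prod.map f f' '' ρ₁ ∪ Prod.map g g' '' ρ₂) : Wins i k w w' ρ := by
  have comp : ∀ {P₁ P₂ P₁' P₂' P P' : Type} [LinearOrder P₁] [LinearOrder P₂] [LinearOrder P₁']
      [LinearOrder P₂'] [LinearOrder P] [LinearOrder P'] {w : P → A} {w' : P' → A}
      {f : P₁ → P} {g : P₂ → P} {f' : P₁' → P'} {g' : P₂' → P'}, StrictMono f → StrictMono g →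
      StrictMono f' → StrictMono g' → (∀ a b, f a < g b) → (∀ a b, f' a < g' b) →
      ∀ {ρ₁ : Set (P₁ × P₁')} {ρ₂ : Set (P₂ × P₂')} {ρ : Set (P × P')},
      Compat (w ∘ f) (w' ∘ f') ρ₁ → Compat (w ∘ g) (w' ∘ g') ρ₂ →
      ρ ⊆ Prod.map f f' '' ρ₁ ∪ Prod.map g g' '' ρ₂ → Compat w w' ρ := by
    intro P₁ P₂ P₁' P₂' P P' _ _ _ _ _ _ w w' f g f' g' hf hg hf' hg' hlt hlt' ρ₁ ρ₂ ρ c₁ c₂ hρ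
      p hp
    have hp' := hρ hp
    refine ⟨?_, fun q hq => ?_⟩
    · rcases hp' with ⟨a, ha, rfl⟩ | ⟨a, ha, rfl⟩
      · exact (c₁ a ha).1
      · exact (c₂ a ha).1
    · rcases hp' with ⟨a, ha, rfl⟩ | ⟨a, ha, rfl⟩ <;> rcases hρ hq with ⟨b, hb, rfl⟩ | ⟨b, hb, rfl⟩
      · simpa [hf.lt_iff_lt, hf'.lt_iff_lt] using (c₁ a ha).2 b hb
      · simp [hlt, hlt']
      · simp [(hlt _ _).not_gt, (hlt' _ _).not_gt]
      · simpa [hg.lt_iff_lt, hg'.lt_iff_lt] using (c₂ a ha).2 b hb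
  induction i generalizing k P P' P₁ P₂ P₁' P₂' with
  | zero => exact wins_zero.2 (comp hf hg hf' hg' hlt hlt' h₁.compat h₂.compat hρ)
  | succ i ih =>
    induction k generalizing ρ ρ₁ ρ₂ with
    | zero => exact wins_rank_zero.2 (comp hf hg hf' hg' hlt hlt' h₁.compat h₂.compat hρ)
    | succ k ihk =>
      refine wins_succ.2 ⟨ih hf' hg' hf hg hlt' hlt hc' hc h₁.swap h₂.swap ?_, fun b => ?_⟩
      · intro p hp
        rcases hρ hp with ⟨a, ha, h⟩ | ⟨a, ha, h⟩
        · exact .inl ⟨a.swap, by simpa using ha, by rw [← p.swap_swap, ← h]; rfl⟩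
        · exact .inr ⟨a.swap, by simpa using ha, by rw [← p.swap_swap, ← h]; rfl⟩
      · rcases hc b with ⟨a, rfl⟩ | ⟨a, rfl⟩
        · obtain ⟨a', ha'⟩ := h₁.exists_answer a
          refine ⟨f' a', ihk ha' h₂.of_rank_succ (Set.insert_subset ?_ (hρ.trans ?_))⟩
          · exact .inl ⟨(a, a'), Set.mem_insert _ _, rfl⟩
          · exact Set.union_subset_union_left _ (Set.image_mono (Set.subset_insert _ _))
        · obtain ⟨a', ha'⟩ := h₂.exists_answer a
          refine ⟨g' a', ihk h₁.of_rank_succ ha' (Set.insert_subset ?_ (hρ.trans ?_))⟩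
          · exact .inr ⟨(a, a'), Set.mem_insert _ _, rfl⟩
          · exact Set.union_subset_union_right _ (Set.image_mono (Set.subset_insert _ _))

/-- If the pebbles on the board delimit corresponding intervals, the images of `f` and `f'`, then
Duplicator also wins the game on these intervals: answers outside of them would violate the order
relative to the delimiting pebbles `σ`. -/
theorem Wins.restrict {P₁ P₁' : Type} [LinearOrder P₁] [LinearOrder P₁'] {f : P₁ → P}
    {f' : P₁' → P'} (hf : StrictMono f) (hf' : StrictMono f')
    (hσ : ∀ b b', Compat w w' (insert (b, b') σ) → (b ∈ Set.range f ↔ b' ∈ Set.range f'))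
    (h : Wins i k w w' ρ) (hσρ : σ ⊆ ρ) {ρ₁ : Set (P₁ × P₁')} (hρ : Prod.map f f' '' ρ₁ ⊆ ρ) :
    Wins i k (w ∘ f) (w' ∘ f') ρ₁ := by
  have comp : ∀ {P₁ P₁' P P' : Type} [LinearOrder P₁] [LinearOrder P₁']
      [LinearOrder P] [LinearOrder P'] {w : P → A} {w' : P' → A}
      {f : P₁ → P} {f' : P₁' → P'}, StrictMono f → StrictMono f' →
      ∀ {ρ₁ : Set (P₁ × P₁')} {ρ : Set (P × P')},
      Compat w w' ρ → Prod.map f f' '' ρ₁ ⊆ ρ → Compat (w ∘ f) (w' ∘ f') ρ₁ := by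
    intro P₁ P₁' P P' _ _ _ _ w w' f f' hf hf' ρ₁ ρ c hρ p hp
    have h1 := c _ (hρ ⟨p, hp, rfl⟩)
    refine ⟨h1.1, fun q hq => ?_⟩
    simpa [hf.lt_iff_lt, hf'.lt_iff_lt] using h1.2 _ (hρ ⟨q, hq, rfl⟩)
  induction i generalizing k P P' P₁ P₁' with
  | zero => exact wins_zero.2 (comp hf hf' h.compat hρ)
  | succ i ih =>
    induction k generalizing ρ ρ₁ with
    | zero => exact wins_rank_zero.2 (comp hf hf' h.compat hρ)
    | succ k ihk =>
      refine wins_succ.2 ⟨ih hf' hf (σ := Prod.swap ⁻¹' σ) (fun b b' hb => ?_) h.swap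
        (Set.preimage_mono hσρ) ?_, fun b => ?_⟩
      · rw [← swap_preimage_insert] at hb
        exact (hσ b' b hb.swap).symm
      · rintro _ ⟨p, hp, rfl⟩
        exact hρ ⟨p.swap, hp, rfl⟩
      · obtain ⟨b', hb'⟩ := h.exists_answer (f b)
        obtain ⟨a', rfl⟩ :=
          (hσ _ _ (hb'.compat.mono (Set.insert_subset_insert hσρ))).1 ⟨b, rfl⟩
        refine ⟨a', ihk hb' (hσρ.trans (Set.subset_insert _ _)) ?_⟩
        rw [Set.image_insert_eq]
        exact Set.insert_subset_insert hρ

/-- Duplicator can answer the first `N` moves of a sequence `p`. -/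
theorem Wins.exists_answers [Nonempty P'] (p : ℕ → P) (N : ℕ)
    (h : Wins (i + 1) (k + N) w w' ρ) :
    ∃ q : ℕ → P', Wins (i + 1) k w w' (ρ ∪ {r | ∃ m < N, r = (p m, q m)}) := by
  induction N generalizing k with
  | zero => exact ⟨fun _ => Classical.arbitrary P', h.mono (by simp)⟩
  | succ N ih =>
    obtain ⟨q, hq⟩ := ih (k := k + 1) (by rwa [add_right_comm, add_assoc])
    obtain ⟨b', hb'⟩ := hq.exists_answer (p N)
    refine ⟨Function.update q N b', hb'.mono ?_⟩
    rintro r (hr | ⟨m, hm, rfl⟩)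
    · exact .inr (.inl hr)
    · rcases Nat.lt_succ_iff_lt_or_eq.1 hm with hm | rfl
      · exact .inr (.inr ⟨m, hm, by rw [Function.update_of_ne hm.ne]⟩)
      · left
        rw [Function.update_self]

end Game

/-! ### Finite supports of `Σ₂` sentences -/

section Support

variable {A : Type*}

/-- `Σ₁` formulas are preserved by embeddings, `Π₁` formulas are reflected. -/
theorem holds_comp_of_inLevel_one {b : Bool} {i n : ℕ}
    {φ : (wordLang A).BoundedFormula Empty n} (hφ : InLevel b i φ) (hi : i ≤ 1)
    {P P' : Type} [LinearOrder P] [LinearOrder P'] {w : P → A} {h : P' → P} (hm : StrictMono h)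
    (ys : Fin n → P') :
    (b = true → Holds (w ∘ h) φ ys → Holds w φ (h ∘ ys)) ∧
      (b = false → Holds w φ (h ∘ ys) → Holds (w ∘ h) φ ys) := by
  have key : ∀ {n : ℕ} {φ : (wordLang A).BoundedFormula Empty n} (ys : Fin n → P'), φ.IsQF →
      (Holds (w ∘ h) φ ys ↔ Holds w φ (h ∘ ys)) :=
    fun _ hq => holds_congr_of_isQF hq (fun _ => rfl) fun _ _ => hm.lt_iff_lt.symm
  induction hφ with
  | qf _ _ hq =>
    have := key ys hq
    exact ⟨fun _ => this.1, fun _ => this.2⟩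
  | @imp b _ _ _ _ _ _ ih₁ ih₂ =>
    have h1 := ih₁ hi ys
    have h2 := ih₂ hi ys
    simp only [holds_imp]
    cases b <;> simp at h1 h2 ⊢ <;> tauto
  | ex _ ih =>
    refine ⟨fun _ => ?_, by simp⟩
    simp only [holds_ex]
    rintro ⟨a, ha⟩
    refine ⟨h a, ?_⟩
    rw [← Fin.comp_snoc]
    exact (ih hi _).1 rfl ha
  | all _ ih =>
    refine ⟨by simp, fun _ => ?_⟩
    simp only [holds_all]
    intro hall a
    refine (ih hi _).2 rfl ?_
    rw [Fin.comp_snoc]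
    exact hall _
  | succ _ h _ =>
    obtain rfl := Nat.le_zero.1 (Nat.le_of_succ_le_succ hi)
    have := key ys h.isQF
    exact ⟨fun _ => this.1, fun _ => this.2⟩

/-- If a `Σ₂` formula is true, or a `Π₂` formula is false, then it remains so in all substructures
that contain a suitable finite set of positions, namely witnesses of the outer quantifiers. -/
theorem exists_support_formula {b : Bool} {i n : ℕ}
    {φ : (wordLang A).BoundedFormula Empty n} (hφ : InLevel b i φ) (hi : i ≤ 2)
    {P : Type} [LinearOrder P] {w : P → A} {xs : Fin n → P} (hx : Holds w φ xs ↔ b = true) :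
    ∃ B : Set P, B.Finite ∧ ∀ {P' : Type} [LinearOrder P'] {h : P' → P}, StrictMono h →
      B ⊆ Set.range h → ∀ ys : Fin n → P', h ∘ ys = xs → (Holds (w ∘ h) φ ys ↔ b = true) := by
  induction hφ with
  | qf _ _ hq =>
    refine ⟨∅, Set.finite_empty, fun {P'} _ h hm _ ys hys => ?_⟩
    rw [← hx, ← hys]
    exact holds_congr_of_isQF hq (fun _ => rfl) fun _ _ => hm.lt_iff_lt.symm
  | @imp b _ _ φ ψ _ _ ih₁ ih₂ =>
    simp only [holds_imp] at hx ⊢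
    cases b with
    | true =>
      by_cases hψ : Holds w ψ xs
      · obtain ⟨B, f, hB⟩ := ih₂ hi (iff_of_true hψ rfl)
        exact ⟨B, f, fun hm hr ys hys =>
          iff_of_true (fun _ => (hB hm hr ys hys).2 rfl) rfl⟩
      · obtain ⟨B, f, hB⟩ := ih₁ hi (iff_of_false (fun hφ => hψ (hx.2 rfl hφ)) (by decide))
        refine ⟨B, f, fun hm hr ys hys => iff_of_true (fun hφ => ?_) rfl⟩
        exact absurd ((hB hm hr ys hys).1 hφ) (by decide)
    | false =>
      simp only [Bool.false_eq_true, iff_false, Classical.not_imp] at hx ⊢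
      obtain ⟨B₁, f₁, hB₁⟩ := ih₁ hi (iff_of_true hx.1 rfl)
      obtain ⟨B₂, f₂, hB₂⟩ := ih₂ hi (iff_of_false hx.2 (by decide))
      refine ⟨B₁ ∪ B₂, f₁.union f₂, fun hm hr ys hys => ⟨?_, fun hψ => ?_⟩⟩
      · exact (hB₁ hm (Set.subset_union_left.trans hr) ys hys).2 rfl
      · exact absurd ((hB₂ hm (Set.subset_union_right.trans hr) ys hys).1 hψ) (by decide)
  | ex _ ih =>
    rw [holds_ex] at hx
    obtain ⟨a, ha⟩ := hx.2 rfl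
    obtain ⟨B, f, hB⟩ := ih hi (xs := Fin.snoc xs a) (by simpa using ha)
    refine ⟨insert a B, f.insert a, fun {P'} _ h hm hr ys hys => ?_⟩
    obtain ⟨a', rfl⟩ := hr (Set.mem_insert _ _)
    rw [holds_ex]
    refine iff_of_true ⟨a', ?_⟩ rfl
    exact (hB hm ((Set.subset_insert _ _).trans hr) _ (by rw [Fin.comp_snoc, hys])).2 rfl
  | all _ ih =>
    simp only [holds_all, Bool.false_eq_true, iff_false, not_forall] at hx
    obtain ⟨a, ha⟩ := hx
    obtain ⟨B, f, hB⟩ := ih hi (xs := Fin.snoc xs a) (by simpa using ha)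
    refine ⟨insert a B, f.insert a, fun {P'} _ h hm hr ys hys => ?_⟩
    obtain ⟨a', rfl⟩ := hr (Set.mem_insert _ _)
    simp only [holds_all, Bool.false_eq_true, iff_false, not_forall]
    refine ⟨a', ?_⟩
    simpa using hB hm ((Set.subset_insert _ _).trans hr) (Fin.snoc ys a')
      (by rw [Fin.comp_snoc, hys])
  | @succ b' b i _ φ hφ ih =>
    by_cases hb : b' = b
    · subst hb
      exact ih (by omega) hx
    · refine ⟨∅, Set.finite_empty, fun {P'} _ h hm _ ys hys => ?_⟩
      have h1 := holds_comp_of_inLevel_one hφ (by omega) (w := w) hm ys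
      rw [hys] at h1
      cases b <;> cases b' <;>
        simp only [reduceCtorEq, iff_true, iff_false, Bool.false_eq_true, not_true_eq_false,
          forall_const, IsEmpty.forall_iff, true_and, and_true] at hb hx h1 ⊢ <;> tauto

/-- A `Σ₂` sentence that holds in `w` holds in all substructures of `w` that contain some fixed
finite set of positions. -/
theorem exists_support {P : Type} [LinearOrder P] {w : P → A} {φ : (wordLang A).Sentence}
    (hφ : IsSigma 2 φ) (hw : Satisfies w φ) :
    ∃ B : Set P, B.Finite ∧ ∀ {P' : Type} [LinearOrder P'] {h : P' → P}, StrictMono h →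
      B ⊆ Set.range h → Satisfies (w ∘ h) φ := by
  obtain ⟨B, f, hB⟩ := exists_support_formula hφ le_rfl (w := w) (xs := Fin.elim0)
    (by simpa [satisfies_iff_holds] using hw)
  refine ⟨B, f, fun hm hr => (satisfies_iff_holds _).2 ?_⟩
  exact (hB hm hr Fin.elim0 (Subsingleton.elim _ _)).2 rfl

end Support

/-! ### The preorders on finite and infinite words -/

section Words

variable {A : Type*} {i k : ℕ}

theorem SigmaLE.trans {P P' P'' : Type} [LT P] [LT P'] [LT P''] {w : P → A} {w' : P' → A}
    {w'' : P'' → A} (h : SigmaLE i k w w') (h' : SigmaLE i k w' w'') : SigmaLE i k w w'' :=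
  fun φ hφ hk hw => h' φ hφ hk (h φ hφ hk hw)

theorem SigmaLE.refl {P : Type} [LT P] (w : P → A) : SigmaLE i k w w := fun _ _ _ h => h

theorem SigmaLE.of_le {P P' : Type} [LT P] [LT P'] {w : P → A} {w' : P' → A} {l : ℕ}
    (h : SigmaLE i l w w') (hk : k ≤ l) : SigmaLE i k w w' :=
  fun φ hφ hr => h φ hφ (hr.trans hk)

theorem sigmaLE_append [Finite A] {l₁ l₂ l₁' l₂' : List A} (h₁ : SigmaLE i k l₁.get l₁'.get)
    (h₂ : SigmaLE i k l₂.get l₂'.get) : SigmaLE i k (l₁ ++ l₂).get (l₁' ++ l₂').get := by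
  let f (l₁ l₂ : List A) : Fin l₁.length → Fin (l₁ ++ l₂).length := fun a =>
    ⟨a, by rw [List.length_append]; omega⟩
  let g (l₁ l₂ : List A) : Fin l₂.length → Fin (l₁ ++ l₂).length := fun a =>
    ⟨l₁.length + a, by rw [List.length_append]; omega⟩
  have hf : ∀ l₁ l₂ : List A, StrictMono (f l₁ l₂) := fun _ _ _ _ h => h
  have hg : ∀ l₁ l₂ : List A, StrictMono (g l₁ l₂) := fun _ _ _ _ h =>
    Fin.mk_lt_mk.2 (Nat.add_lt_add_left h _)
  have hlt : ∀ (l₁ l₂ : List A) a b, f l₁ l₂ a < g l₁ l₂ b := fun _ _ a b =>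
    Fin.mk_lt_mk.2 (a.2.trans_le (Nat.le_add_right _ _))
  have hc : ∀ (l₁ l₂ : List A) p, p ∈ Set.range (f l₁ l₂) ∪ Set.range (g l₁ l₂) := by
    intro l₁ l₂ p
    have hp : p.1 < l₁.length + l₂.length := p.2.trans_eq List.length_append
    by_cases h : p.1 < l₁.length
    · exact .inl ⟨⟨p, h⟩, rfl⟩
    · exact .inr ⟨⟨p - l₁.length, by omega⟩, Fin.ext (by simp only [g]; omega)⟩
  have hl : ∀ l₁ l₂ : List A, (l₁ ++ l₂).get ∘ f l₁ l₂ = l₁.get := fun l₁ l₂ =>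
    funext fun a => by simp [f]
  have hr : ∀ l₁ l₂ : List A, (l₁ ++ l₂).get ∘ g l₁ l₂ = l₂.get := fun l₁ l₂ =>
    funext fun a => by simp [g]
  rw [sigmaLE_iff_wins] at h₁ h₂ ⊢
  rw [← hl l₁ l₂, ← hl l₁' l₂'] at h₁
  rw [← hr l₁ l₂, ← hr l₁' l₂'] at h₂
  exact .append (hf _ _) (hg _ _) (hf _ _) (hg _ _) (hlt _ _) (hlt _ _) (hc _ _) (hc _ _) h₁ h₂
    (Set.empty_subset _)

theorem sigmaLE_append_stream [Finite A] {l l' : List A} {x x' : Stream' A}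
    (h₁ : SigmaLE i k l.get l'.get) (h₂ : SigmaLE i k x.get x'.get) :
    SigmaLE i k (l ++ₛ x).get (l' ++ₛ x').get := by
  have hf : ∀ l : List A, StrictMono (fun a : Fin l.length => (a : ℕ)) := fun _ _ _ h => h
  have hg : ∀ l : List A, StrictMono (fun a : ℕ => l.length + a) := fun _ _ _ h =>
    Nat.add_lt_add_left h _
  have hlt : ∀ (l : List A) (a : Fin l.length) (b : ℕ), (a : ℕ) < l.length + b := fun _ a b =>
    a.2.trans_le (Nat.le_add_right _ _)
  have hc : ∀ (l : List A) (p : ℕ), p ∈ Set.range (fun a : Fin l.length => (a : ℕ)) ∪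
      Set.range (fun a : ℕ => l.length + a) := by
    intro l p
    by_cases h : p < l.length
    · exact .inl ⟨⟨p, h⟩, rfl⟩
    · exact .inr ⟨p - l.length, by simp only; omega⟩
  have hl : ∀ (l : List A) (x : Stream' A),
      (l ++ₛ x).get ∘ (fun a : Fin l.length => (a : ℕ)) = l.get := fun l x =>
    funext fun a => Stream'.get_append_left _ _ _ a.2
  have hr : ∀ (l : List A) (x : Stream' A),
      (l ++ₛ x).get ∘ (fun a : ℕ => l.length + a) = x.get := fun l x =>
    funext fun a => Stream'.get_append_right _ _ _
  rw [sigmaLE_iff_wins] at h₁ h₂ ⊢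
  rw [← hl l x, ← hl l' x'] at h₁
  rw [← hr l x, ← hr l' x'] at h₂
  exact .append (hf _) (hg _) (hf _) (hg _) (hlt _) (hlt _) (hc _) (hc _) h₁ h₂
    (Set.empty_subset _)

theorem SigmaLEFin.mul [Finite A] {u u' v v' : FreeSemigroup A} (h : SigmaLEFin i k u v)
    (h' : SigmaLEFin i k u' v') : SigmaLEFin i k (u * u') (v * v') :=
  sigmaLE_append h h'

theorem SigmaLEFin.smul [Finite A] {u v : FreeSemigroup A} {x y : Stream' A}
    (h : SigmaLEFin i k u v) (h' : SigmaLEInf i k x y) : SigmaLEInf i k (u • x) (v • y) :=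
  sigmaLE_append_stream h h'

theorem SigmaLEFin.posPow [Finite A] {u v : FreeSemigroup A} (h : SigmaLEFin i k u v) (n : ℕ) :
    SigmaLEFin i k (posPow u n) (posPow v n) := by
  induction n with
  | zero => exact h
  | succ n ih => exact ih.mul h

end Words

/-! ### Powers and products in ω-semigroups -/

section Products

variable {S T : Type*} [Semigroup S] [OmegaSemigroup S T]

theorem posPow_mul_posPow (s : S) (m n : ℕ) : posPow s m * posPow s n = posPow s (m + n + 1) := by
  refine WithOne.coe_inj.1 ?_
  rw [WithOne.coe_mul, coe_posPow, coe_posPow, coe_posPow, ← pow_add]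
  congr 1
  omega

theorem posPow_map {S' : Type*} [Semigroup S'] (f : S →ₙ* S') (s : S) (n : ℕ) :
    f (posPow s n) = posPow (f s) n := by
  induction n with
  | zero => rfl
  | succ n ih => rw [posPow, map_mul, ih, posPow]

theorem blockProd_map {S' : Type*} [Semigroup S'] (f : S →ₙ* S') (s : ℕ → S) (j n : ℕ) :
    f (blockProd s j n) = blockProd (fun m => f (s m)) j n := by
  induction n with
  | zero => rfl
  | succ n ih => rw [blockProd, map_mul, ih, blockProd]

theorem blockProd_const (s : S) (j n : ℕ) : blockProd (fun _ => s) j n = posPow s n := by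
  induction n with
  | zero => rfl
  | succ n ih => rw [blockProd, ih, posPow]

theorem blockProd_shift (s : ℕ → S) (p j n : ℕ) :
    blockProd (fun m => s (m + p)) j n = blockProd s (j + p) n := by
  induction n with
  | zero => rfl
  | succ n ih =>
    rw [blockProd, ih, blockProd]
    congr 2
    omega

/-- The product of the factors `c m` with `a ≤ m < b`; it is meaningful for `a < b`. -/
def segProd (c : ℕ → S) (a b : ℕ) : S := blockProd c a (b - a - 1)

theorem segProd_mul_segProd (c : ℕ → S) {a b d : ℕ} (h : a < b) (h' : b < d) :
    segProd c a b * segProd c b d = segProd c a d := by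
  have h1 := blockProd_mul_blockProd c a (b - a - 1) (d - b - 1)
  rwa [show a + (b - a - 1) + 1 = b by omega,
    show b - a - 1 + (d - b - 1) + 1 = d - a - 1 by omega] at h1

theorem iprod_eq_segProd_smul (c : ℕ → S) {p : ℕ} (hp : 0 < p) :
    (OmegaSemigroup.iprod c : T) =
      segProd c 0 p • (OmegaSemigroup.iprod (fun n => c (n + p)) : T) := by
  obtain ⟨p, rfl⟩ : ∃ q, p = q + 1 := ⟨p - 1, by omega⟩
  clear hp
  change _ = blockProd c 0 p • _
  have cons : ∀ f : ℕ → S, (OmegaSemigroup.iprod f : T) =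
      f 0 • (OmegaSemigroup.iprod (fun n => f (n + 1)) : T) := by
    intro f
    rw [OmegaSemigroup.smul_iprod]
    congr 1
    funext n
    cases n <;> rfl
  induction p with
  | zero => exact cons c
  | succ p ih =>
    rw [ih, cons, blockProd, mul_smul]
    simp only [zero_add, add_assoc, add_comm 1]

/-- An infinite product whose factors can be grouped into blocks with product `s` is `s^∞`. -/
theorem iprod_eq_infPow (c : ℕ → S) (s : S) {n : ℕ → ℕ} (hn : StrictMono n)
    (hs : ∀ m, segProd c (n m) (n (m + 1)) = s) (j : ℕ) :
    OmegaSemigroup.iprod (fun m => c (m + n j)) = infPow T s := by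
  have hle : ∀ m, n j ≤ n (j + m) := fun m => hn.monotone (Nat.le_add_right _ _)
  rw [OmegaSemigroup.iprod_blocks _ (fun m => n (j + m) - n j) ?_ (by simp), infPow]
  · congr 1
    funext m
    rw [blockProd_shift, ← hs (j + m), segProd]
    have h1 := hle m
    have h2 := hle (m + 1)
    have h3 : n (j + (m + 1)) = n (j + m + 1) := rfl
    congr 1 <;> omega
  · refine strictMono_nat_of_lt_succ fun m => ?_
    have h1 := hle m
    have h2 : n (j + m) < n (j + (m + 1)) := hn (by omega)
    omega

theorem segProd_eq_posPow (c : ℕ → S) (s : S) {n : ℕ → ℕ} (hn : StrictMono n)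
    (hs : ∀ m, segProd c (n m) (n (m + 1)) = s) (j d : ℕ) :
    segProd c (n j) (n (j + d + 1)) = posPow s d := by
  induction d with
  | zero => exact hs j
  | succ d ih =>
    rw [← segProd_mul_segProd c (hn (show j < j + d + 1 by omega))
      (hn (show j + d + 1 < j + (d + 1) + 1 by omega)), ih, posPow]
    congr 1
    exact hs _

theorem infPow_posPow (s : S) (d : ℕ) : infPow T (posPow s d) = infPow T s := by
  rw [infPow, infPow, OmegaSemigroup.iprod_blocks (fun _ => s) (fun m => m * (d + 1)) ?_ (by simp)]
  · congr 1
    funext m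
    rw [blockProd_const]
    congr 1
    rw [add_mul, one_mul]
    omega
  · exact strictMono_nat_of_lt_succ fun m => by rw [add_mul]; omega

theorem posPow_smul_infPow (s : S) (n : ℕ) : posPow s n • infPow T s = infPow T s := by
  have h := iprod_eq_segProd_smul (T := T) (fun _ : ℕ => s) n.succ_pos
  rw [segProd, blockProd_const] at h
  exact h.symm

theorem OmegaHom.map_infPow {S' T' : Type*} [Semigroup S'] [OmegaSemigroup S' T']
    (α : OmegaHom S T S' T') (s : S) : α.inf (infPow T s) = infPow T' (α.fin s) :=
  α.map_iprod _

/-- Arbitrarily large powers of `s` are equal to `s ^ ω`. -/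
theorem exists_posPow_eq_omegaPow [Finite S] (s : S) (N : ℕ) :
    ∃ n ≥ N, posPow s n = omegaPow s := by
  classical
  have hi : IsIdempotentElem (omegaPow s) := Nat.find_spec (exists_idempotent_exponent S) s
  have h : ∀ N, ∃ n ≥ N, posPow s n = omegaPow s := by
    intro N
    induction N with
    | zero => exact ⟨_, Nat.zero_le _, rfl⟩
    | succ N ih =>
      obtain ⟨n, hn, h⟩ := ih
      refine ⟨n + n + 1, by omega, ?_⟩
      rw [← posPow_mul_posPow, h, hi.eq]
  exact h N

theorem mul_omegaPow_of_mul_eq [Finite S] {r s : S} (h : r * s = r) : r * omegaPow s = r := by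
  obtain ⟨n, -, hn⟩ := exists_posPow_eq_omegaPow s 0
  rw [← hn]
  clear hn
  induction n with
  | zero => exact h
  | succ n ih => rw [posPow, ← mul_assoc, ih, h]

/-- Every sequence over a finite semigroup can be cut into blocks such that all blocks except for
the first one have the same product. An ultrafilter `U` gives each position `a` a colour, the value
of `segProd c a b` for `U`-almost all `b`, and the cuts are made at positions whose colour is the
`U`-almost everywhere constant one. -/
theorem exists_factorization [Finite S] (c : ℕ → S) :
    ∃ (s : S) (n : ℕ → ℕ), StrictMono n ∧ 0 < n 0 ∧ ∀ m, segProd c (n m) (n (m + 1)) = s := by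
  let U : Ultrafilter ℕ := Filter.hyperfilter ℕ
  have hU : ∀ f : ℕ → S, ∃ s, ∀ᶠ m in (U : Filter ℕ), f m = s := by
    intro f
    obtain ⟨s, hs⟩ := (U.map f).eq_pure_of_finite
    refine ⟨s, ?_⟩
    have : {s} ∈ U.map f := by rw [hs]; exact Set.mem_singleton s
    exact this
  have hgt : ∀ a, ∀ᶠ m in (U : Filter ℕ), a < m := fun a =>
    Nat.hyperfilter_le_atTop (Filter.eventually_gt_atTop a)
  choose f hf using fun a => hU (segProd c a)
  obtain ⟨s, hs⟩ := hU f
  obtain ⟨a₀, h₀, hs₀⟩ := ((hgt 0).and hs).exists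
  have step : ∀ a : {a // f a = s}, ∃ b : {a // f a = s}, a.1 < b.1 ∧ segProd c a.1 b.1 = s := by
    rintro ⟨a, rfl⟩
    obtain ⟨b, h1, h2, h3⟩ := ((hgt a).and ((hf a).and hs)).exists
    exact ⟨⟨b, h3⟩, h1, h2⟩
  choose next h1 h2 using step
  refine ⟨s, fun m => (next^[m] ⟨a₀, hs₀⟩).1, strictMono_nat_of_lt_succ fun m => ?_, h₀,
    fun m => ?_⟩
  · rw [Function.iterate_succ_apply']
    exact h1 _
  · simp only [Function.iterate_succ_apply']
    exact h2 _

end Products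

/-! ### Factors of infinite words -/

section Factors

variable {A : Type*}

/-- The sequence of letters of an infinite word, as words of length one. -/
def letterSeq (x : Stream' A) : ℕ → FreeSemigroup A := fun n => FreeSemigroup.of (x.get n)

theorem letters_blockProd_letterSeq (x : Stream' A) (a n : ℕ) :
    letters (blockProd (letterSeq x) a n) = (List.range (n + 1)).map fun j => x.get (a + j) := by
  induction n with
  | zero => rfl
  | succ n ih =>
    rw [blockProd, letters_mul, ih, List.range_succ (n := n + 1), List.map_append]
    rfl

theorem iprod_letterSeq (x : Stream' A) : OmegaSemigroup.iprod (letterSeq x) = x := by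
  change concat (letterSeq x) = x
  refine Stream'.ext fun n => Option.some_injective _ ?_
  rw [← concat_spec _ n n (lt_length_blockProd _ 0 n), letters_blockProd_letterSeq]
  simp

/-- The factor of `x` at the positions `m` with `a ≤ m < b`, for `a < b`. -/
def factor (x : Stream' A) (a b : ℕ) : FreeSemigroup A := segProd (letterSeq x) a b

theorem letters_factor (x : Stream' A) {a b : ℕ} (h : a < b) :
    letters (factor x a b) = (List.range (b - a)).map fun j => x.get (a + j) := by
  rw [factor, segProd, letters_blockProd_letterSeq]
  congr 2
  omega

theorem iprod_drop (x : Stream' A) (p : ℕ) :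
    OmegaSemigroup.iprod (fun n => letterSeq x (n + p)) = x.drop p :=
  iprod_letterSeq (x.drop p)

theorem factor_smul_drop (x : Stream' A) {p : ℕ} (hp : 0 < p) :
    factor x 0 p • x.drop p = x := by
  conv_rhs => rw [← iprod_letterSeq x, iprod_eq_segProd_smul _ hp, iprod_drop]
  rfl

theorem get_infPow (u : FreeSemigroup A) (j : ℕ) {m : ℕ} (hm : m < (letters u).length) :
    (infPow (Stream' A) u).get ((letters u).length * j + m) = (letters u)[m] := by
  have h : infPow (Stream' A) u = letters u ++ₛ infPow (Stream' A) u :=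
    (posPow_smul_infPow u 0).symm
  induction j with
  | zero =>
    rw [h, Nat.mul_zero, Nat.zero_add]
    exact Stream'.get_append_left _ _ _ hm
  | succ j ih =>
    rw [h, show (letters u).length * (j + 1) + m =
      (letters u).length + ((letters u).length * j + m) by ring, Stream'.get_append_right, ih]

theorem contentInf_infPow (u : FreeSemigroup A) :
    contentInf (infPow (Stream' A) u) = contentFin u := by
  ext a
  constructor
  · rintro ⟨p, rfl⟩
    have hm := Nat.mod_lt p (show 0 < (letters u).length by simp [letters])
    rw [← Nat.div_add_mod p (letters u).length, get_infPow u _ hm]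
    exact List.getElem_mem hm
  · intro ha
    obtain ⟨m, hm, rfl⟩ := List.mem_iff_getElem.1 ha
    exact ⟨_, get_infPow u 0 hm⟩

theorem lt_length_posPow (u : FreeSemigroup A) (n : ℕ) : n < (letters (posPow u n)).length := by
  rw [← blockProd_const u 0]
  exact lt_length_blockProd _ 0 n

end Factors

/-! ### Infinite powers and long finite powers -/

section Powers

variable {A : Type*}

/-- If all letters of `x` occur in `u`, then `posPow u N • x` embeds into `u^∞ = posPow u N • u^∞`
by a map that fixes the positions of the prefix `posPow u N`: the `j`-th letter of `x` is found in
the `j`-th factor `u` of the tail. Only the positions up to `N` are needed as fixed points, and the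
prefix is longer than `N`. -/
theorem exists_embedding_posPow_smul (u : FreeSemigroup A) {x : Stream' A}
    (hx : contentInf x ⊆ contentFin u) (N : ℕ) :
    ∃ h : ℕ → ℕ, StrictMono h ∧ (∀ q ≤ N, h q = q) ∧
      (infPow (Stream' A) u).get ∘ h = (posPow u N • x).get := by
  have hr : ∀ j, ∃ (m : ℕ) (hm : m < (letters u).length), (letters u)[m] = x.get j := fun j =>
    List.mem_iff_getElem.1 (hx ⟨j, rfl⟩)
  choose r hr1 hr2 using hr
  set L := (letters (posPow u N)).length with hL
  set n := (letters u).length with hn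
  have hNL : N < L := lt_length_posPow u N
  refine ⟨fun q => if q < L then q else L + (n * (q - L) + r (q - L)),
    strictMono_nat_of_lt_succ fun q => ?_, fun q hq => if_pos (by omega), ?_⟩
  · by_cases h1 : q + 1 < L
    · simp only [h1, if_true, show q < L by omega, Nat.lt_succ_self]
    · by_cases h2 : q < L
      · simp only [h1, h2, if_true, if_false]
        omega
      · have h3 := hr1 (q - L)
        have h4 : q + 1 - L = q - L + 1 := by omega
        simp only [h1, h2, if_false, h4, Nat.mul_add, Nat.mul_one]
        omega
  · have hu : infPow (Stream' A) u = letters (posPow u N) ++ₛ infPow (Stream' A) u :=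
      (posPow_smul_infPow u N).symm
    change _ = (letters (posPow u N) ++ₛ x).get
    funext q
    by_cases h : q < L
    · simp only [Function.comp_apply, h, if_true]
      rw [hu, Stream'.get_append_left _ _ _ h, Stream'.get_append_left _ _ _ h]
    · obtain ⟨j, rfl⟩ := Nat.exists_eq_add_of_le (not_lt.1 h)
      simp only [Function.comp_apply, h, if_false, Nat.add_sub_cancel_left]
      rw [hu, hL, Stream'.get_append_right, Stream'.get_append_right, get_infPow u j (hr1 j), hr2]

/-- A `Σ₂` sentence that holds in `u^∞` holds in `posPow u N • x` as soon as the prefix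
`posPow u N` contains a finite support of the sentence. -/
theorem eventually_infPow_sigmaLE_posPow_smul [Finite A] (k : ℕ) (u : FreeSemigroup A)
    {x : Stream' A} (hx : contentInf x ⊆ contentFin u) :
    ∀ᶠ N in Filter.atTop, SigmaLEInf 2 k (infPow (Stream' A) u) (posPow u N • x) := by
  obtain ⟨F, hF, hF1, hF2⟩ := exists_finite_sentences A 2 k
  have h1 : ∀ φ ∈ F, ∀ᶠ N in Filter.atTop, Satisfies (infPow (Stream' A) u).get φ →
      Satisfies (posPow u N • x).get φ := by
    intro φ hφ
    by_cases hu : Satisfies (infPow (Stream' A) u).get φ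
    · obtain ⟨B, hB, hB1⟩ := exists_support (hF1 φ hφ).1 hu
      obtain ⟨M, hM⟩ := hB.bddAbove
      filter_upwards [Filter.eventually_ge_atTop M] with N hN _
      obtain ⟨h, hm, hfix, hlab⟩ := exists_embedding_posPow_smul u hx N
      rw [← hlab]
      exact hB1 hm fun b hb => ⟨b, hfix b ((hM hb).trans hN)⟩
    · exact .of_forall fun N h => absurd h hu
  filter_upwards [(Filter.eventually_all_finite hF).2 h1] with N hN
  exact (hF2 _ _ hN).sigmaLE

end Powers

/-! ### Comparing factors between pebbles -/

section Between

variable {A : Type*} {x y : Stream' A} {ρ : Set (ℕ × ℕ)} {i k : ℕ}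

/-- Factors at corresponding intervals are related if the pebbles `σ` on the board delimit these
intervals. -/
theorem Wins.sigmaLEFin_factor {a b a' b' : ℕ} (hab : a < b) (hab' : a' < b')
    (h : Wins i k x.get y.get ρ)
    {σ : Set (ℕ × ℕ)} (hσρ : σ ⊆ ρ)
    (hσ : ∀ c c', Compat x.get y.get (insert (c, c') σ) →
      (c ∈ Set.Ico a b ↔ c' ∈ Set.Ico a' b')) :
    SigmaLEFin i k (factor x a b) (factor y a' b') := by
  have hlen : ∀ (x : Stream' A) {a b : ℕ}, a < b → (letters (factor x a b)).length
      = b - a := fun x _ _ h => by rw [letters_factor x h]; simp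
  have hlab : ∀ (x : Stream' A) {a b : ℕ}, a < b → x.get ∘
      (fun j : Fin (letters (factor x a b)).length => a + (j : ℕ)) =
        (letters (factor x a b)).get := by
    intro x a b h
    funext j
    simp [letters_factor x h]
  have hran : ∀ (x : Stream' A) {a b : ℕ}, a < b → Set.range
      (fun j : Fin (letters (factor x a b)).length => a + (j : ℕ)) = Set.Ico a b := by
    intro x a b h
    ext c
    constructor
    · rintro ⟨j, rfl⟩
      have := j.2.trans_eq (hlen x h)
      exact ⟨Nat.le_add_right _ _, by simp only; omega⟩
    · rintro ⟨h1, h2⟩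
      exact ⟨⟨c - a, by rw [hlen x h]; omega⟩, by simp only; omega⟩
  refine Wins.sigmaLE ?_
  rw [← hlab x hab, ← hlab y hab']
  refine h.restrict (f := fun j : Fin (letters (factor x a b)).length => a + (j : ℕ))
    (f' := fun j : Fin (letters (factor y a' b')).length => a' + (j : ℕ)) (ρ₁ := ∅)
    (fun _ _ h => Nat.add_lt_add_left h _) (fun _ _ h => Nat.add_lt_add_left h _)
    (fun c c' hc => ?_) hσρ (by simp)
  rw [hran x hab, hran y hab']
  exact hσ c c' hc

theorem Wins.factor_between {a b a' b' : ℕ} (hab : a < b) (h : Wins i k x.get y.get ρ)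
    (ha : (a, a') ∈ ρ) (hb : (b, b') ∈ ρ) : SigmaLEFin i k (factor x a b) (factor y a' b') := by
  have hab' : a' < b' := ((h.compat _ ha).2 _ hb).1 hab
  refine h.sigmaLEFin_factor hab hab' (σ := {(a, a'), (b, b')})
    (Set.insert_subset ha (by simpa using hb)) ?_
  intro c c' hc
  have h0 := (hc (c, c') (by simp)).2
  have h1 := h0 (a, a') (by simp)
  have h2 := h0 (b, b') (by simp)
  simp only [Set.mem_Ico, ← not_lt] at h1 h2 ⊢
  rw [h1, h2]

theorem Wins.factor_prefix {b b' : ℕ} (hb : 0 < b) (hb' : 0 < b') (h : Wins i k x.get y.get ρ)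
    (hρ : (b, b') ∈ ρ) : SigmaLEFin i k (factor x 0 b) (factor y 0 b') := by
  refine h.sigmaLEFin_factor hb hb' (σ := {(b, b')}) (by simpa using hρ) ?_
  intro c c' hc
  have h2 := (hc (c, c') (by simp)).2 (b, b') (by simp)
  simpa using h2

theorem Wins.drop {a a' : ℕ} (h : Wins i k x.get y.get ρ) (ha : (a, a') ∈ ρ) :
    Wins i k (x.drop a).get (y.drop a').get ∅ := by
  have hlab : ∀ (x : Stream' A) (a : ℕ), x.get ∘ (fun j => a + j) = (x.drop a).get := fun x a =>
    funext fun j => (Stream'.get_drop _ _ _).symm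
  have hran : ∀ a : ℕ, Set.range (fun j => a + j) = Set.Ici a := by
    intro a
    ext c
    exact ⟨by rintro ⟨j, rfl⟩; exact Nat.le_add_right _ _,
      fun h => ⟨c - a, Nat.add_sub_cancel' h⟩⟩
  rw [← hlab x a, ← hlab y a']
  refine h.restrict (ρ₁ := ∅) (σ := {(a, a')}) (fun _ _ h => Nat.add_lt_add_left h _)
    (fun _ _ h => Nat.add_lt_add_left h _) (fun c c' hc => ?_) (by simpa using ha) (by simp)
  have h2 := (hc (c, c') (by simp)).2 (a, a') (by simp)
  rw [hran, hran, Set.mem_Ici, Set.mem_Ici, ← not_lt, ← not_lt]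
  exact not_congr h2

/-- One round on each side shows that the same letters occur. -/
theorem Wins.contentInf_eq (h : Wins (i + 2) (k + 1) x.get y.get ρ) :
    contentInf x = contentInf y := by
  have key : ∀ {i : ℕ} {x y : Stream' A} {ρ : Set (ℕ × ℕ)},
      Wins (i + 1) (k + 1) x.get y.get ρ → contentInf x ⊆ contentInf y := by
    rintro i x y ρ h _ ⟨b, rfl⟩
    obtain ⟨b', hb'⟩ := h.exists_answer b
    exact ⟨b', (hb'.compat (b, b') (Set.mem_insert _ _)).1.symm⟩
  exact (key h).antisymm (key h.swap)

end Between

/-! ### Chains of length two -/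

section Chains

variable {A S T : Type*} [Semigroup S] [OmegaSemigroup S T]

theorem mem_chains_two {W R : Type*} {le : ℕ → W → W → Prop} {β : W → R} {s : Fin 2 → R} :
    s ∈ chains le 2 β ↔ ∀ k, ∃ u v, le k u v ∧ β u = s 0 ∧ β v = s 1 := by
  refine forall_congr' fun k => ⟨?_, ?_⟩
  · rintro ⟨w, h1, h2⟩
    exact ⟨w 0, w 1, h1 0 (by omega), h2 0, h2 1⟩
  · rintro ⟨u, v, h, hu, hv⟩
    refine ⟨![u, v], fun j hj => ?_, fun j => ?_⟩
    · obtain rfl : j = 0 := by omega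
      exact h
    · fin_cases j
      · exact hu
      · exact hv

/-- The pair `(s₁, s₂)` is the image of a pair of finite words `u ≤ₖ v`. -/
def IsChainAt (α : OmegaHom (FreeSemigroup A) (Stream' A) S T) (k : ℕ) (s₁ s₂ : S) : Prop :=
  ∃ u v, SigmaLEFin 2 k u v ∧ α.fin u = s₁ ∧ α.fin v = s₂

theorem IsChainAt.of_le {α : OmegaHom (FreeSemigroup A) (Stream' A) S T} {k l : ℕ} {s₁ s₂ : S}
    (h : IsChainAt α l s₁ s₂) (hk : k ≤ l) : IsChainAt α k s₁ s₂ := by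
  obtain ⟨u, v, h, hu, hv⟩ := h
  exact ⟨u, v, h.of_le hk, hu, hv⟩

/-- If `x` and `y` are compared with a rank that exceeds `k` by more than `|S| + 1`, then their
images have the required form, for pairs of finite words compared with rank `k`. The word `x` is
cut into blocks with the same image, and Duplicator's answers to the first `|S| + 1` cuts cut `y`.
Two of the corresponding prefixes of `y` have the same image `r₂`, so `r₂ s₂ = r₂` for the image
`s₂` of the factor in between. -/
theorem exists_decomposition [Finite A] [Finite S]
    (α : OmegaHom (FreeSemigroup A) (Stream' A) S T) (hα : AlphabetCompatible α) {k : ℕ}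
    {x y : Stream' A} (h : SigmaLEInf 2 (k + 1 + (Nat.card S + 1)) x y) :
    ∃ (r₁ r₂ s₁ s₂ : S) (t₂ : T), IsChainAt α k r₁ r₂ ∧ IsChainAt α k s₁ s₂ ∧
      t₂ ∈ Set.range α.inf ∧ alphFin α s₁ = alphInf α t₂ ∧
      α.inf x = r₁ • infPow T s₁ ∧ α.inf y = (r₂ * omegaPow s₂) • t₂ := by
  obtain ⟨s, n, hn, hn0, hs⟩ := exists_factorization fun m => α.fin (letterSeq x m)
  have hfin : ∀ (x : Stream' A) a b,
      α.fin (factor x a b) = segProd (fun m => α.fin (letterSeq x m)) a b :=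
    fun x a b => blockProd_map _ _ _ _
  obtain ⟨q, hq⟩ := (sigmaLE_iff_wins.1 h).exists_answers n (Nat.card S + 1)
  set ρ : Set (ℕ × ℕ) := ∅ ∪ {r | ∃ m < Nat.card S + 1, r = (n m, q m)}
  have hρ : ∀ m < Nat.card S + 1, (n m, q m) ∈ ρ := fun m hm => .inr ⟨m, hm, rfl⟩
  have hq0 : ∀ m < Nat.card S + 1, 0 < q m := by
    intro m hm
    obtain ⟨b', hb'⟩ := hq.exists_answer 0
    have h1 := (hb'.compat (0, b') (Set.mem_insert _ _)).2 (n m, q m) (.inr (hρ m hm))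
    exact (Nat.zero_le b').trans_lt (h1.1 (hn0.trans_le (hn.monotone (Nat.zero_le m))))
  obtain ⟨a, b, hb, hab, he⟩ : ∃ a b, b < Nat.card S + 1 ∧ a < b ∧
      α.fin (factor y 0 (q a)) = α.fin (factor y 0 (q b)) := by
    by_contra! hc
    have hinj : Function.Injective
        fun m : Fin (Nat.card S + 1) => α.fin (factor y 0 (q m)) := by
      intro m m' hm
      rcases lt_trichotomy m m' with hlt | heq | hlt
      · exact absurd hm (hc m m' m'.2 hlt)
      · exact heq
      · exact absurd hm.symm (hc m' m m.2 hlt)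
    have := Nat.card_le_card_of_injective _ hinj
    rw [Nat.card_fin] at this
    omega
  have ha : a < Nat.card S + 1 := hab.trans hb
  obtain ⟨d, rfl⟩ := Nat.exists_eq_add_of_lt hab
  have hqab : q a < q (a + d + 1) := ((hq.compat _ (hρ _ ha)).2 _ (hρ _ hb)).1 (hn hab)
  have hna : 0 < n a := hn0.trans_le (hn.monotone (Nat.zero_le a))
  have hs1 : α.fin (factor x (n a) (n (a + d + 1))) = posPow s d := by
    rw [hfin, segProd_eq_posPow _ s hn hs]
  have htail : ∀ j, α.inf (x.drop (n j)) = infPow T s := by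
    intro j
    rw [← iprod_drop, α.map_iprod]
    exact iprod_eq_infPow _ s hn hs j
  refine ⟨α.fin (factor x 0 (n a)), α.fin (factor y 0 (q a)),
    α.fin (factor x (n a) (n (a + d + 1))), α.fin (factor y (q a) (q (a + d + 1))),
    α.inf (y.drop (q (a + d + 1))), ?_, ?_, ⟨_, rfl⟩, ?_, ?_, ?_⟩
  · exact ⟨_, _, (hq.factor_prefix hna (hq0 a ha) (hρ a ha)).of_le (Nat.le_succ k), rfl, rfl⟩
  · exact ⟨_, _, (hq.factor_between (hn hab) (hρ a ha) (hρ _ hb)).of_le (Nat.le_succ k), rfl, rfl⟩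
  · -- the factor `u` of `x` satisfies `α(u^∞) = s^∞`, which is the image of a tail of `x`
    rw [hα.alphFin_eq, hα.alphInf_eq, ← contentInf_infPow,
      ← (hq.drop (hρ _ hb)).contentInf_eq (i := 0)]
    refine hα.2 _ _ ?_
    rw [α.map_infPow, hs1, infPow_posPow, htail]
  · rw [hs1, infPow_posPow, ← htail a, ← α.map_smul, factor_smul_drop x hna]
  · rw [mul_omegaPow_of_mul_eq, he, ← α.map_smul, factor_smul_drop y (hq0 _ hb)]
    rw [hfin y (q a), hfin, segProd_mul_segProd _ (hq0 a ha) hqab, ← hfin, ← he, hfin]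

/-- For each rank a pair of infinite words witnessing that `(r₁ s₁^∞, r₂ s₂^ω t₂)` is a chain is
`u₀ u₁^∞ ≤ₖ u₀ u₁ᴺ x ≤ₖ v₀ v₁ᴺ x`. -/
theorem satSigma2_subset [Finite A] [Finite S]
    (α : OmegaHom (FreeSemigroup A) (Stream' A) S T) (hα : AlphabetCompatible α) :
    satSigma2 α ⊆ sigmaChainsInf 2 2 α.inf := by
  rintro _ ⟨r₁, r₂, s₁, s₂, _, hr, hs, ⟨x, rfl⟩, hx, rfl⟩
  refine mem_chains_two.2 fun k => ?_
  obtain ⟨u₀, v₀, h₀, hu₀, hv₀⟩ := mem_chains_two.1 hr k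
  obtain ⟨u₁, v₁, h₁, hu₁, hv₁⟩ := mem_chains_two.1 hs k
  obtain rfl : α.fin u₀ = r₁ := hu₀
  obtain rfl : α.fin v₀ = r₂ := hv₀
  obtain rfl : α.fin u₁ = s₁ := hu₁
  obtain rfl : α.fin v₁ = s₂ := hv₁
  rw [hα.alphFin_eq, hα.alphInf_eq] at hx
  obtain ⟨N₀, hN₀⟩ :=
    Filter.eventually_atTop.1 (eventually_infPow_sigmaLE_posPow_smul k u₁ hx.ge)
  obtain ⟨N, hN, hω⟩ := exists_posPow_eq_omegaPow (α.fin v₁) N₀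
  refine ⟨u₀ • infPow (Stream' A) u₁, (v₀ * posPow v₁ N) • x, ?_, ?_, ?_⟩
  · rw [mul_smul]
    exact (SigmaLEFin.smul (SigmaLE.refl _) (hN₀ N hN)).trans
      (h₀.smul ((h₁.posPow N).smul (SigmaLE.refl _)))
  · rw [α.map_smul, α.map_infPow]
    rfl
  · rw [α.map_smul, map_mul, posPow_map, hω]
    rfl

theorem sigmaChainsInf_subset [Finite A] [Finite S] [Finite T]
    (α : OmegaHom (FreeSemigroup A) (Stream' A) S T) (hα : AlphabetCompatible α) :
    sigmaChainsInf 2 2 α.inf ⊆ satSigma2 α := by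
  intro t ht
  let Q (k : ℕ) (z : S × S × S × S × T) : Prop :=
    IsChainAt α k z.1 z.2.1 ∧ IsChainAt α k z.2.2.1 z.2.2.2.1 ∧
      z.2.2.2.2 ∈ Set.range α.inf ∧ alphFin α z.2.2.1 = alphInf α z.2.2.2.2 ∧
      t 0 = z.1 • infPow T z.2.2.1 ∧ t 1 = (z.2.1 * omegaPow z.2.2.2.1) • z.2.2.2.2
  have hex : ∀ k, ∃ z, Q k z := by
    intro k
    obtain ⟨x, y, h, hx, hy⟩ := mem_chains_two.1 ht (k + 1 + (Nat.card S + 1))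
    obtain ⟨r₁, r₂, s₁, s₂, t₂, h⟩ := exists_decomposition α hα h
    rw [hx, hy] at h
    exact ⟨(r₁, r₂, s₁, s₂, t₂), h⟩
  have hmono : ∀ {k l z}, k ≤ l → Q l z → Q k z := fun hk h =>
    ⟨h.1.of_le hk, h.2.1.of_le hk, h.2.2⟩
  -- finitely many tuples are available, so one of them works for all ranks
  obtain ⟨z, hz⟩ : ∃ z, ∀ k, Q k z := by
    by_contra! hc
    choose K hK using hc
    obtain ⟨M, hM⟩ := (Set.finite_range K).bddAbove
    obtain ⟨z, hz⟩ := hex M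
    exact hK z (hmono (hM ⟨z, rfl⟩) hz)
  obtain ⟨-, -, h1, h2, h3, h4⟩ := hz 0
  refine ⟨z.1, z.2.1, z.2.2.1, z.2.2.2.1, z.2.2.2.2, mem_chains_two.2 fun k => (hz k).1,
    mem_chains_two.2 fun k => (hz k).2.1, h1, h2, ?_⟩
  funext j
  fin_cases j
  · exact h3
  · exact h4

end Chains

end OmegaWords

theorem mainTheorem2 {A S T : Type*} [Finite A] [Semigroup S] [Finite S] [Finite T]
    [OmegaWords.OmegaSemigroup S T]
    (α : OmegaWords.OmegaHom (FreeSemigroup A) (Stream' A) S T)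
    (hα : OmegaWords.AlphabetCompatible α) :
    OmegaWords.sigmaChainsInf 2 2 α.inf = OmegaWords.satSigma2 α :=
  (OmegaWords.sigmaChainsInf_subset α hα).antisymm (OmegaWords.satSigma2_subset α hα)
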